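/- **Model.** A two-sided queue has server types $i\in[n]$, customer types $j\in[m]$, a compatibility graph $E\subseteq[n]\times[m]$, supply curves $G_i$ and demand curves $F_j$ (price as a function of the arrival rate) defined on nondegenerate intervals $\mathrm{dom}(G_i),\mathrm{dom}(F_j)\subseteq[0,\infty)$, and a holding cost $s>0$ per waiting agent and unit of time. The $G_i$ are strictly increasing, the $F_j$ strictly decreasing, all are twice continuously differentiable, the revenues $r_j(x)=xF_j(x)$ are concave and the costs $c_i(x)=xG_i(x)$ are convex. The state is the vector $q=(q^{(1)},q^{(2)})\in\mathbb Z_+^{n}\times\mathbb Z_+^{m}$ of numbers of waiting servers and customers. In state $q$, type-$j$ customers arrive at rate $\lambda_j(q)$ and type-$i$ servers at rate $\mu_i(q)$ (the pricing policy; the rates must lie in the domains). Upon each arrival a matching policy (stationary, possibly randomized, depending on the state and on the arrival) chooses numbers $x_{ij}\in\mathbb Z_+$ of compatible pairs, $x_{ij}=0$ for $(i,j)\notin E$, with $\sum_i x_{ij}$ and $\sum_j x_{ij}$ at most the queue lengths including the new arrival; matched agents leave. The system is stable if the state $0$ is positive recurrent for the resulting Markov chain (uniformized at any constant that bounds the total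 arrival rate). Its long-run average profit, started from the empty system, is the long-run average of $\sum_j r_j(\lambda_j(q))-\sum_i c_i(\mu_i(q))-s\big(\sum_i q^{(1)}_i+\sum_j q^{(2)}_j\big)$. The fluid problem is to maximize $\sum_j r_j(\lambda_j)-\sum_i c_i(\mu_i)$ over $\lambda_j=\sum_i\chi_{ij}\in\mathrm{dom}(F_j)$, $\mu_i=\sum_j\chi_{ij}\in\mathrm{dom}(G_i)$, $\chi_{ij}\ge0$, $\chi_{ij}=0$ for $(i,j)\notin E$. The $\eta$-th system ($\eta\in\mathbb N$, $\eta\ge1$) has the same graph and holding cost and the curves $F_j(\cdot/\eta)$, $G_i(\cdot/\eta)$. The profit loss $L^\eta\in(-\infty,+\infty]$ of a policy is the optimal value of the fluid problem of the $\eta$-th system minus the long-run average profit in that system. Let $(\lambda^*,\mu^*)$ be an optimal solution of the fluid problem of the system $\eta=1$, with $\sum_j\lambda^*_j>0$, and with $r_j''(\lambda_j^*)<0$ for all $j$ and $c_i''(\mu_i^*)>0$ for all $i$ (one-sided derivatives at an endpoint of the domain). **Condition.** For functions $f_j,g_i$ of the scaled queue lengths and exponents $0\le\alpha\le1$, $0<\beta<1$: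 (a) $|f_j(q/\eta^\alpha)|\le M_j$ and $|g_i(q/\eta^\alpha)|\le N_i$ for all $i,j$, all states $q$ and all $\eta\ge1$; (b) $0<\alpha+\beta\le1$; (c) with constants $\kappa,\delta>0$, for all $\eta\ge1$ and all states $q$: if $q^{(2)}_j/\eta^\alpha>\kappa$, then $f_j(q/\eta^\alpha)<-\delta$ or $g_i(q/\eta^\alpha)>\delta$ for some $i$ with $(i,j)\in E$; if $q^{(1)}_i/\eta^\alpha>\kappa$, then $g_i(q/\eta^\alpha)<-\delta$ or $f_j(q/\eta^\alpha)>\delta$ for some $j$ with $(i,j)\in E$. **Theorem.** There is a constant $K>0$, depending only on the system, $(\lambda^*,\mu^*)$, $f$, $g$ and the constants $M,N,\kappa,\delta$, such that the following holds for all $\alpha,\beta$ satisfying the Condition and all integers $\eta\ge1$. Suppose that the pricing policy $$\lambda_j(q)=\eta\lambda_j^*+f_j\!\left(\tfrac{q}{\eta^\alpha}\right)\eta^\beta,\qquad \mu_i(q)=\eta\mu_i^*+g_i\!\left(\tfrac{q}{\eta^\alpha}\right)\eta^\beta$$ is admissible in the $\eta$-th system, that is, $\lambda_j(q)/\eta\in\mathrm{dom}(F_j)$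 and $\mu_i(q)/\eta\in\mathrm{dom}(G_i)$ for all $i,j$ and all states $q$. Then under every matching policy that makes the $\eta$-th system stable, $$L^\eta\ \ge\ K\,\eta^{1/3}.$$ -/

import Mathlib

open scoped ENNReal

noncomputable section

namespace TwoSided

/-- Queue lengths: `q.1 i` servers of type `i` and `q.2 j` customers of type `j` are waiting. -/
abbrev State (n m : ℕ) : Type := (Fin n → ℕ) × (Fin m → ℕ)

/-- Types of arrivals: `Sum.inl i` is a server of type `i`, `Sum.inr j` a customer of type `j`. -/
abbrev Arrival (n m : ℕ) : Type := Fin n ⊕ Fin m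

/-- Number of customers and servers waiting. -/
def State.total {n m : ℕ} (q : State n m) : ℕ := ∑ i, q.1 i + ∑ j, q.2 j

/-- The state just after an arrival, before any match. -/
def State.add {n m : ℕ} (q : State n m) : Arrival n m → State n m
  | Sum.inl i => (Function.update q.1 i (q.1 i + 1), q.2)
  | Sum.inr j => (q.1, Function.update q.2 j (q.2 j + 1))

/-- The state after the matches `x` (`x i j` servers of type `i` matched to customers of type `j`)
have left. Used only for `x` feasible in `q`, where the subtractions do not truncate. -/
def State.remove {n m : ℕ} (q : State n m) (x : Fin n → Fin m → ℕ) : State n m :=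
  (fun i => q.1 i - ∑ j, x i j, fun j => q.2 j - ∑ i, x i j)

/-- The data of a two-sided queue with `n` server types and `m` customer types: the compatibility
graph, the supply curves (server arrival rate to price) and demand curves (customer arrival rate
to price), each with its domain, and the holding cost of one waiting agent per unit of time. -/
structure TwoSidedQueue (n m : ℕ) where
  compat : Fin n → Fin m → Prop
  supplyDom : Fin n → Set ℝ
  supply : Fin n → ℝ → ℝ
  demandDom : Fin m → Set ℝ
  demand : Fin m → ℝ → ℝ
  holdingCost : ℝ

/-- Domains of arrival rates: nondegenerate intervals of nonnegative numbers. -/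
structure IsRateDomain (D : Set ℝ) : Prop where
  nonneg : ∀ x ∈ D, 0 ≤ x
  convex : Convex ℝ D
  interior_nonempty : (interior D).Nonempty

namespace TwoSidedQueue

variable {n m : ℕ}

/-- Revenue per unit of time from customers of type `j` at arrival rate `x`. -/
def revenue (Q : TwoSidedQueue n m) (j : Fin m) (x : ℝ) : ℝ := x * Q.demand j x

/-- Cost per unit of time of servers of type `i` at arrival rate `x`. -/
def cost (Q : TwoSidedQueue n m) (i : Fin n) (x : ℝ) : ℝ := x * Q.supply i x

/-- Standing assumptions: supply curves strictly increasing, demand curves strictly decreasing,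
both twice continuously differentiable; revenues concave, costs convex; positive holding cost. -/
structure Regular (Q : TwoSidedQueue n m) : Prop where
  supplyDom : ∀ i, IsRateDomain (Q.supplyDom i)
  demandDom : ∀ j, IsRateDomain (Q.demandDom j)
  supply_strictMono : ∀ i, StrictMonoOn (Q.supply i) (Q.supplyDom i)
  demand_strictAnti : ∀ j, StrictAntiOn (Q.demand j) (Q.demandDom j)
  supply_contDiff : ∀ i, ContDiffOn ℝ 2 (Q.supply i) (Q.supplyDom i)
  demand_contDiff : ∀ j, ContDiffOn ℝ 2 (Q.demand j) (Q.demandDom j)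
  revenue_concave : ∀ j, ConcaveOn ℝ (Q.demandDom j) (Q.revenue j)
  cost_convex : ∀ i, ConvexOn ℝ (Q.supplyDom i) (Q.cost i)
  holdingCost_pos : 0 < Q.holdingCost

/-- The `r`-th system of the asymptotic regime: `F^r (r x) = F x` and `G^r (r x) = G x`. -/
def scale (Q : TwoSidedQueue n m) (r : ℝ) : TwoSidedQueue n m where
  compat := Q.compat
  supplyDom := fun i => {x | x / r ∈ Q.supplyDom i}
  supply := fun i x => Q.supply i (x / r)
  demandDom := fun j => {x | x / r ∈ Q.demandDom j}
  demand := fun j x => Q.demand j (x / r)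
  holdingCost := Q.holdingCost

/-! ### The fluid problem -/

/-- The constraints of the fluid problem. -/
structure FluidFeasible (Q : TwoSidedQueue n m) (lam : Fin m → ℝ) (mu : Fin n → ℝ)
    (chi : Fin n → Fin m → ℝ) : Prop where
  lam_mem : ∀ j, lam j ∈ Q.demandDom j
  mu_mem : ∀ i, mu i ∈ Q.supplyDom i
  lam_eq : ∀ j, lam j = ∑ i, chi i j
  mu_eq : ∀ i, mu i = ∑ j, chi i j
  chi_nonneg : ∀ i j, 0 ≤ chi i j
  chi_zero : ∀ i j, ¬ Q.compat i j → chi i j = 0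

/-- The objective of the fluid problem. -/
def fluidObjective (Q : TwoSidedQueue n m) (lam : Fin m → ℝ) (mu : Fin n → ℝ) : ℝ :=
  ∑ j, Q.revenue j (lam j) - ∑ i, Q.cost i (mu i)

/-- `(lam, mu)` is an optimal solution of the fluid problem. -/
def FluidOptimal (Q : TwoSidedQueue n m) (lam : Fin m → ℝ) (mu : Fin n → ℝ) : Prop :=
  (∃ chi, Q.FluidFeasible lam mu chi) ∧
    ∀ lam' mu' chi', Q.FluidFeasible lam' mu' chi' →
      Q.fluidObjective lam' mu' ≤ Q.fluidObjective lam mu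

/-- The optimal value of the fluid problem. -/
def fluidValue (Q : TwoSidedQueue n m) : ℝ :=
  sSup {v | ∃ lam mu chi, Q.FluidFeasible lam mu chi ∧ v = Q.fluidObjective lam mu}

/-- `x` is a feasible set of matches when the queue lengths are `q`. -/
structure Matchable (Q : TwoSidedQueue n m) (q : State n m) (x : Fin n → Fin m → ℕ) : Prop where
  customers : ∀ j, ∑ i, x i j ≤ q.2 j
  servers : ∀ i, ∑ j, x i j ≤ q.1 i
  compat : ∀ i j, ¬ Q.compat i j → x i j = 0

end TwoSidedQueue

/-! ### Policies and the induced Markov chain -/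

/-- A (stationary) pricing policy, given by the arrival rates it induces in each state. -/
structure PricingPolicy (n m : ℕ) where
  lam : State n m → Fin m → ℝ
  mu : State n m → Fin n → ℝ

namespace PricingPolicy

variable {n m : ℕ}

/-- All arrival rates lie in the domains of the supply and demand curves. -/
def Admissible (p : PricingPolicy n m) (Q : TwoSidedQueue n m) : Prop :=
  ∀ q, (∀ j, p.lam q j ∈ Q.demandDom j) ∧ (∀ i, p.mu q i ∈ Q.supplyDom i)

/-- The rate of arrivals of type `a` in state `q`. -/
def rate (p : PricingPolicy n m) (q : State n m) : Arrival n m → ℝ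
  | Sum.inl i => p.mu q i
  | Sum.inr j => p.lam q j

/-- The total rate of arrivals in state `q`. -/
def totalRate (p : PricingPolicy n m) (q : State n m) : ℝ := ∑ a, p.rate q a

end PricingPolicy

/-- A (stationary, possibly randomized) matching policy: upon an arrival of type `a` in state `q`,
matches feasible for the queue lengths including the arrival are chosen. -/
structure MatchingPolicy {n m : ℕ} (Q : TwoSidedQueue n m) where
  choose : State n m → Arrival n m → PMF (Fin n → Fin m → ℕ)
  feasible : ∀ q a, ∀ x ∈ (choose q a).support, Q.Matchable (q.add a) x

section Chain

variable {n m : ℕ} {Q : TwoSidedQueue n m}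

/-- Transition probabilities of the Markov chain of queue lengths, uniformized at rate `c`: an
arrival of type `a` takes place with probability `rate a / c` and is followed by the matches;
with the remaining probability nothing happens. Meant for `c` above all total arrival rates. -/
def transition (p : PricingPolicy n m) (σ : MatchingPolicy Q) (c : ℝ) (q q' : State n m) : ℝ≥0∞ :=
  ∑ a, ENNReal.ofReal (p.rate q a / c) * ((σ.choose q a).map (q.add a).remove) q' +
    Set.indicator {q} (fun _ => ENNReal.ofReal (1 - p.totalRate q / c)) q'

/-- The law of the chain after `k` steps, started from the empty system. -/
def law (p : PricingPolicy n m) (σ : MatchingPolicy Q) (c : ℝ) : ℕ → State n m → ℝ≥0∞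
  | 0 => Set.indicator {0} 1
  | k + 1 => fun q' => ∑' q, law p σ c k q * transition p σ c q q'

/-- `lawBeforeReturn p σ c k q` is the probability that the chain, started from the empty system,
is in `q` after `k` steps and was not in the empty state at any of the steps `1, …, k`. -/
def lawBeforeReturn (p : PricingPolicy n m) (σ : MatchingPolicy Q) (c : ℝ) :
    ℕ → State n m → ℝ≥0∞
  | 0 => Set.indicator {0} 1
  | k + 1 => Set.indicator {0}ᶜ
      (fun q' => ∑' q, lawBeforeReturn p σ c k q * transition p σ c q q')

/-- The expected return time to the empty state, `∑ₖ P(T > k)`. -/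
def meanReturnTime (p : PricingPolicy n m) (σ : MatchingPolicy Q) (c : ℝ) : ℝ≥0∞ :=
  ∑' k, ∑' q, lawBeforeReturn p σ c k q

/-- Stability: the empty state, hence its communicating class, is positive recurrent. -/
def Stable (p : PricingPolicy n m) (σ : MatchingPolicy Q) (c : ℝ) : Prop :=
  meanReturnTime p σ c < ⊤

/-- The rate at which profit is made in state `q`, including the holding cost. -/
def profitRate (Q : TwoSidedQueue n m) (p : PricingPolicy n m) (q : State n m) : ℝ :=
  ∑ j, Q.revenue j (p.lam q j) - ∑ i, Q.cost i (p.mu q i) - Q.holdingCost * q.total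

/-- The expected average profit rate over the first `N` steps from the empty system. The sum over
the states has finitely many nonzero terms, since at most `k` agents wait after `k` steps. -/
def averageProfit (p : PricingPolicy n m) (σ : MatchingPolicy Q) (c : ℝ) (N : ℕ) : ℝ :=
  (∑ k ∈ Finset.range N, ∑' q, (law p σ c k q).toReal * profitRate Q p q) / N

/-- The long-run average profit per unit of time; it is `⊥` if the mean queue length is infinite. -/
def longRunProfit (p : PricingPolicy n m) (σ : MatchingPolicy Q) (c : ℝ) : EReal :=
  Filter.limsup (fun N => (averageProfit p σ c N : EReal)) Filter.atTop

/-- The profit loss with respect to the optimal value of the fluid problem. -/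
def profitLoss (p : PricingPolicy n m) (σ : MatchingPolicy Q) (c : ℝ) : EReal :=
  (Q.fluidValue : EReal) - longRunProfit p σ c

end Chain

/-! ### The family of pricing policies -/

section Family

variable {n m : ℕ}

/-- The scaled queue lengths `q / η ^ α`. -/
def scaledState (α : ℝ) (η : ℕ) (q : State n m) : (Fin n → ℝ) × (Fin m → ℝ) :=
  (fun i => q.1 i / (η : ℝ) ^ α, fun j => q.2 j / (η : ℝ) ^ α)

/-- The pricing policy `λ_j = η λ*_j + f_j(q / η^α) η^β`, `μ_i = η μ*_i + g_i(q / η^α) η^β`. -/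
def generalPolicy (lam : Fin m → ℝ) (mu : Fin n → ℝ)
    (f : Fin m → (Fin n → ℝ) × (Fin m → ℝ) → ℝ) (g : Fin n → (Fin n → ℝ) × (Fin m → ℝ) → ℝ)
    (α β : ℝ) (η : ℕ) : PricingPolicy n m where
  lam := fun q j => η * lam j + f j (scaledState α η q) * (η : ℝ) ^ β
  mu := fun q i => η * mu i + g i (scaledState α η q) * (η : ℝ) ^ β

/-- The conditions on the pricing policies: bounded adjustments, the range of the exponents, and
the drift condition, with the constants `M`, `N`, `κ`, `δ`. -/
structure PricingCondition (Q : TwoSidedQueue n m)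
    (f : Fin m → (Fin n → ℝ) × (Fin m → ℝ) → ℝ) (g : Fin n → (Fin n → ℝ) × (Fin m → ℝ) → ℝ)
    (M : Fin m → ℝ) (N : Fin n → ℝ) (κ δ α β : ℝ) : Prop where
  f_bounded : ∀ η : ℕ, 1 ≤ η → ∀ q j, |f j (scaledState α η q)| ≤ M j
  g_bounded : ∀ η : ℕ, 1 ≤ η → ∀ q i, |g i (scaledState α η q)| ≤ N i
  alpha_mem : 0 ≤ α ∧ α ≤ 1
  beta_mem : 0 < β ∧ β < 1
  exponents : 0 < α + β ∧ α + β ≤ 1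
  customer_drift : ∀ η : ℕ, 1 ≤ η → ∀ (q : State n m) (j : Fin m), κ < q.2 j / (η : ℝ) ^ α →
    f j (scaledState α η q) < -δ ∨ ∃ i, Q.compat i j ∧ δ < g i (scaledState α η q)
  server_drift : ∀ η : ℕ, 1 ≤ η → ∀ (q : State n m) (i : Fin n), κ < q.1 i / (η : ℝ) ^ α →
    g i (scaledState α η q) < -δ ∨ ∃ j, Q.compat i j ∧ δ < f j (scaledState α η q)

end Family

end TwoSided

end

/-! Let `z` be the number of waiting customers minus that of waiting servers. A match does not
change `z`, so under every matching policy `z` is a walk with steps `±1` and up and down rates near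
`η L`, where `L` is the total fluid rate. Confining `z` to a window of width `1 / θ` takes a drift
of order `η θ`. Such a drift moves the rates off the fluid optimum, which costs (deviation)² `/ η`,
of order `η θ²`, because the curvature there is strict. A window of that width costs `1 / θ` in
holding. The two costs balance at `θ = η ^ (-1/3)`, where both are of order `η ^ (1/3)`.

The trade-off is made exact by the bounded test function `-cos (θ z)`. Its generator is at least of
order `η θ²`, up to errors proportional to `|z|` and to the deviations (`generator_cos_ge`). The
holding cost absorbs the first error, the quadratic loss (`exists_quadratic_loss`) the second. This
gives a pointwise bound on the profit rate (`profitRate_le`) that contains, besides the gain, a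
generator term and a term linear in the deviations.

Both extra terms are harmless on average. By Dynkin's formula the generator of a bounded function
averages to zero. For the linear term no stationary law is needed: a profit above the claimed level
bounds the mean queue along a subsequence of horizons, so the average rates converge there to those
of a matching flow (`exists_limit_flow`), and `first_order` makes the linear term nonpositive.
`longRunProfit_le` combines these facts. -/

noncomputable section

namespace TwoSided

/-! ### Expectations under finitely supported laws -/

section Expect

variable {ι κ : Type*}

/-- The expectation of `φ` under `p`. -/
def expect (p : PMF ι) (φ : ι → ℝ) : ℝ := ∑' a, (p a).toReal * φ a

/-- All laws used below have finite support, so expectations are finite sums and summability never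
has to be checked. -/
theorem expect_eq_sum {p : PMF ι} {s : Finset ι} (hs : p.support ⊆ s) (φ : ι → ℝ) :
    expect p φ = ∑ a ∈ s, (p a).toReal * φ a := by
  refine tsum_eq_sum fun a ha => ?_
  have : p a = 0 := by
    by_contra h
    exact ha (hs ((PMF.mem_support_iff p a).2 h))
  simp [this]

theorem expect_eq_sum_toFinset {p : PMF ι} (hp : p.support.Finite) (φ : ι → ℝ) :
    expect p φ = ∑ a ∈ hp.toFinset, (p a).toReal * φ a :=
  expect_eq_sum (by simp) φ

theorem expect_fintype [Fintype ι] (p : PMF ι) (φ : ι → ℝ) :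
    expect p φ = ∑ a, (p a).toReal * φ a := tsum_fintype _

theorem expect_pure (a : ι) (φ : ι → ℝ) : expect (PMF.pure a) φ = φ a := by
  classical
  rw [expect_eq_sum (s := {a}) (by simp)]
  simp

theorem expect_const {p : PMF ι} (hp : p.support.Finite) (r : ℝ) :
    expect p (fun _ => r) = r := by
  rw [expect_eq_sum_toFinset hp, ← Finset.sum_mul,
    ← ENNReal.toReal_sum fun a _ => p.apply_ne_top a]
  have : ∑ a ∈ hp.toFinset, p a = 1 := by
    rw [← p.tsum_coe]
    refine (tsum_eq_sum fun a ha => ?_).symm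
    simpa using ha
  simp [this]

theorem expect_add {p : PMF ι} (hp : p.support.Finite) (φ ψ : ι → ℝ) :
    expect p (fun a => φ a + ψ a) = expect p φ + expect p ψ := by
  simp only [expect_eq_sum_toFinset hp, mul_add, Finset.sum_add_distrib]

theorem expect_sub {p : PMF ι} (hp : p.support.Finite) (φ ψ : ι → ℝ) :
    expect p (fun a => φ a - ψ a) = expect p φ - expect p ψ := by
  simp only [expect_eq_sum_toFinset hp, mul_sub, Finset.sum_sub_distrib]

theorem expect_mul_left (p : PMF ι) (r : ℝ) (φ : ι → ℝ) :
    expect p (fun a => r * φ a) = r * expect p φ := by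
  simp only [expect, ← tsum_mul_left]
  exact tsum_congr fun a => by ring

theorem expect_sum {p : PMF ι} (hp : p.support.Finite) (s : Finset κ) (φ : κ → ι → ℝ) :
    expect p (fun a => ∑ k ∈ s, φ k a) = ∑ k ∈ s, expect p (φ k) := by
  simp only [expect_eq_sum_toFinset hp, Finset.mul_sum]
  exact Finset.sum_comm

theorem expect_mono {p : PMF ι} (hp : p.support.Finite) {φ ψ : ι → ℝ}
    (h : ∀ a ∈ p.support, φ a ≤ ψ a) : expect p φ ≤ expect p ψ := by
  simp only [expect_eq_sum_toFinset hp]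
  exact Finset.sum_le_sum fun a ha =>
    mul_le_mul_of_nonneg_left (h a (by simpa using ha)) ENNReal.toReal_nonneg

theorem expect_congr {p : PMF ι} (hp : p.support.Finite) {φ ψ : ι → ℝ}
    (h : ∀ a ∈ p.support, φ a = ψ a) : expect p φ = expect p ψ :=
  le_antisymm (expect_mono hp fun a ha => (h a ha).le) (expect_mono hp fun a ha => (h a ha).ge)

theorem support_bind_finite {p : PMF ι} {g : ι → PMF κ} (hp : p.support.Finite)
    (hg : ∀ a, (g a).support.Finite) : (p.bind g).support.Finite := by
  rw [PMF.support_bind]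
  exact hp.biUnion fun a _ => hg a

theorem expect_bind {p : PMF ι} {g : ι → PMF κ} (hp : p.support.Finite)
    (hg : ∀ a, (g a).support.Finite) (φ : κ → ℝ) :
    expect (p.bind g) φ = expect p (fun a => expect (g a) φ) := by
  classical
  have hb := support_bind_finite hp hg
  have hsub : ∀ a ∈ hp.toFinset, (g a).support ⊆ hb.toFinset := by
    intro a ha b hb'
    rw [Set.Finite.coe_toFinset, PMF.support_bind]
    exact Set.mem_biUnion (by simpa using ha) hb'
  have happ : ∀ b, ((p.bind g) b).toReal =
      ∑ a ∈ hp.toFinset, (p a).toReal * (g a b).toReal := by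
    intro b
    rw [PMF.bind_apply, tsum_eq_sum (s := hp.toFinset)
      (fun a ha => by simp [show p a = 0 by simpa using ha]),
      ENNReal.toReal_sum fun a _ => ENNReal.mul_ne_top (p.apply_ne_top a) ((g a).apply_ne_top b)]
    simp only [ENNReal.toReal_mul]
  rw [expect_eq_sum_toFinset hb, expect_eq_sum_toFinset hp]
  simp only [happ, Finset.sum_mul]
  rw [Finset.sum_comm]
  refine Finset.sum_congr rfl fun a ha => ?_
  rw [expect_eq_sum (hsub a ha), Finset.mul_sum]
  exact Finset.sum_congr rfl fun b _ => by ring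

theorem support_map_finite {p : PMF ι} (f : ι → κ) (hp : p.support.Finite) :
    (p.map f).support.Finite := by
  rw [PMF.support_map]
  exact hp.image f

theorem expect_map {p : PMF ι} (hp : p.support.Finite) (f : ι → κ) (φ : κ → ℝ) :
    expect (p.map f) φ = expect p (fun a => φ (f a)) := by
  have := expect_bind (g := PMF.pure ∘ f) hp (fun a => by simp) φ
  simpa [PMF.bind_pure_comp, expect_pure] using this

/-- A bounded variable with values in a convex set of reals has its mean there, and so has a
finite average of means. -/
theorem sum_expect_mem_convex {p : ℕ → PMF ι} (hp : ∀ k, (p k).support.Finite) {D : Set ℝ}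
    (hD : Convex ℝ D) {φ : ι → ℝ} (h : ∀ a, φ a ∈ D) {N : ℕ} (hN : 0 < N) :
    (∑ k ∈ Finset.range N, expect (p k) φ) / N ∈ D := by
  have h1 : ∀ k, expect (p k) φ ∈ D := by
    intro k
    rw [expect_eq_sum_toFinset (hp k)]
    refine hD.sum_mem (fun _ _ => ENNReal.toReal_nonneg) ?_ fun a _ => h a
    have := expect_const (hp k) 1
    rw [expect_eq_sum_toFinset (hp k)] at this
    simpa using this
  have h2 := hD.sum_mem (t := Finset.range N) (w := fun _ => (1 : ℝ) / N)
    (z := fun k => expect (p k) φ) (fun _ _ => by positivity)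
    (by simp; field_simp) fun k _ => h1 k
  simp only [smul_eq_mul, ← Finset.mul_sum] at h2
  convert h2 using 1
  ring

end Expect

/-! ### The chain of queue lengths as a sequence of finitely supported laws -/

section Chain

variable {n m : ℕ} {Q : TwoSidedQueue n m}

/-- The queue lengths bound each entry of a match. Hence even a randomized matching policy has
finitely many outcomes, and the law of the chain stays finitely supported at every step. -/
theorem matchable_finite (Q : TwoSidedQueue n m) (q : State n m) :
    {x | Q.Matchable q x}.Finite := by
  refine (Set.finite_Iic (fun _ j => q.2 j : Fin n → Fin m → ℕ)).subset fun x hx i j => ?_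
  exact (Finset.single_le_sum (f := fun i => x i j) (fun _ _ => Nat.zero_le _)
    (Finset.mem_univ i)).trans (hx.customers j)

theorem MatchingPolicy.support_finite (σ : MatchingPolicy Q) (q : State n m) (a : Arrival n m) :
    (σ.choose q a).support.Finite :=
  (matchable_finite Q (q.add a)).subset (σ.feasible q a)

/-- Rates that can be uniformized at `c`. -/
structure Uniformizable (p : PricingPolicy n m) (c : ℝ) : Prop where
  pos : 0 < c
  rate_nonneg : ∀ q a, 0 ≤ p.rate q a
  totalRate_le : ∀ q, p.totalRate q ≤ c

variable {p : PricingPolicy n m} {c : ℝ}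

/-- The next event of the uniformized chain: an arrival, or nothing. -/
def nextEvent (hp : Uniformizable p c) (q : State n m) : PMF (Option (Arrival n m)) :=
  PMF.ofFintype
    (fun o => o.elim (ENNReal.ofReal (1 - p.totalRate q / c))
      fun a => ENNReal.ofReal (p.rate q a / c)) (by
    have hc := hp.pos
    rw [Fintype.sum_option]
    simp only [Option.elim]
    rw [← ENNReal.ofReal_sum_of_nonneg fun a _ => div_nonneg (hp.rate_nonneg q a) hc.le,
      ← Finset.sum_div, ← ENNReal.ofReal_add]
    · simp [PricingPolicy.totalRate]
    · rw [sub_nonneg, div_le_one hc]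
      exact hp.totalRate_le q
    · exact div_nonneg (Finset.sum_nonneg fun a _ => hp.rate_nonneg q a) hc.le)

/-- The state after an event. -/
def afterEvent (σ : MatchingPolicy Q) (q : State n m) : Option (Arrival n m) → PMF (State n m)
  | none => PMF.pure q
  | some a => (σ.choose q a).map (q.add a).remove

theorem afterEvent_support_finite (σ : MatchingPolicy Q) (q : State n m)
    (o : Option (Arrival n m)) : (afterEvent σ q o).support.Finite := by
  cases o with
  | none => simp [afterEvent]
  | some a => exact support_map_finite _ (σ.support_finite q a)

/-- One step of the uniformized chain. -/
def step (hp : Uniformizable p c) (σ : MatchingPolicy Q) (q : State n m) : PMF (State n m) :=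
  (nextEvent hp q).bind (afterEvent σ q)

theorem step_support_finite (hp : Uniformizable p c) (σ : MatchingPolicy Q) (q : State n m) :
    (step hp σ q).support.Finite :=
  support_bind_finite (Set.toFinite _) (afterEvent_support_finite σ q)

theorem step_apply (hp : Uniformizable p c) (σ : MatchingPolicy Q) (q q' : State n m) :
    step hp σ q q' = transition p σ c q q' := by
  rw [step, PMF.bind_apply, tsum_fintype, Fintype.sum_option, transition, add_comm]
  congr 1
  by_cases h : q' = q <;> simp [nextEvent, afterEvent, h]

/-- The law of the chain after `k` steps from the empty system. -/
def chainLaw (hp : Uniformizable p c) (σ : MatchingPolicy Q) : ℕ → PMF (State n m)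
  | 0 => PMF.pure 0
  | k + 1 => (chainLaw hp σ k).bind (step hp σ)

theorem chainLaw_support_finite (hp : Uniformizable p c) (σ : MatchingPolicy Q) (k : ℕ) :
    (chainLaw hp σ k).support.Finite := by
  induction k with
  | zero => simp [chainLaw]
  | succ k ih => exact support_bind_finite ih (step_support_finite hp σ)

theorem chainLaw_apply (hp : Uniformizable p c) (σ : MatchingPolicy Q) (k : ℕ) (q : State n m) :
    chainLaw hp σ k q = law p σ c k q := by
  induction k generalizing q with
  | zero => by_cases h : q = 0 <;> simp [chainLaw, law, h]
  | succ k ih => simp only [chainLaw, law, PMF.bind_apply, step_apply, ih]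

theorem averageProfit_eq (hp : Uniformizable p c) (σ : MatchingPolicy Q) (N : ℕ) :
    averageProfit p σ c N =
      (∑ k ∈ Finset.range N, expect (chainLaw hp σ k) (profitRate Q p)) / N := by
  simp only [averageProfit, expect, chainLaw_apply]

/-- The generator of the chain. -/
def generator (p : PricingPolicy n m) (σ : MatchingPolicy Q) (φ : State n m → ℝ)
    (q : State n m) : ℝ :=
  ∑ a, p.rate q a * expect (σ.choose q a) (fun x => φ ((q.add a).remove x) - φ q)

/-- One step of the uniformized chain acts as the identity plus `1 / c` times the generator; the
holding probability supplies the identity. -/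
theorem expect_step (hp : Uniformizable p c) (σ : MatchingPolicy Q) (φ : State n m → ℝ)
    (q : State n m) : expect (step hp σ q) φ = φ q + generator p σ φ q / c := by
  have hc := hp.pos
  rw [step, expect_bind (Set.toFinite _) (afterEvent_support_finite σ q), expect_fintype,
    Fintype.sum_option]
  have h0 : 0 ≤ 1 - (∑ a, p.rate q a) / c := by
    rw [sub_nonneg, div_le_one hc]
    exact hp.totalRate_le q
  have h1 : ∀ a, 0 ≤ p.rate q a / c := fun a => div_nonneg (hp.rate_nonneg q a) hc.le
  simp only [nextEvent, PMF.ofFintype_apply, Option.elim, afterEvent, expect_pure,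
    ENNReal.toReal_ofReal h0, ENNReal.toReal_ofReal (h1 _), expect_map (σ.support_finite q _),
    generator, expect_sub (σ.support_finite q _), expect_const (σ.support_finite q _), mul_sub,
    Finset.sum_sub_distrib, PricingPolicy.totalRate, ← Finset.sum_mul]
  have : ∀ a, p.rate q a / c * expect (σ.choose q a) (fun x => φ ((q.add a).remove x)) =
      p.rate q a * expect (σ.choose q a) (fun x => φ ((q.add a).remove x)) / c :=
    fun a => by ring
  simp only [this, ← Finset.sum_div]
  ring

theorem expect_chainLaw_succ (hp : Uniformizable p c) (σ : MatchingPolicy Q)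
    (φ : State n m → ℝ) (k : ℕ) :
    expect (chainLaw hp σ (k + 1)) φ =
      expect (chainLaw hp σ k) φ + expect (chainLaw hp σ k) (generator p σ φ) / c := by
  have hk := chainLaw_support_finite hp σ k
  rw [chainLaw, expect_bind hk (step_support_finite hp σ)]
  simp only [expect_step]
  rw [expect_add hk, div_eq_inv_mul, ← expect_mul_left]
  simp only [div_eq_inv_mul]

/-- Dynkin's formula. -/
theorem sum_expect_generator (hp : Uniformizable p c) (σ : MatchingPolicy Q)
    (φ : State n m → ℝ) (N : ℕ) :
    ∑ k ∈ Finset.range N, expect (chainLaw hp σ k) (generator p σ φ) =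
      c * (expect (chainLaw hp σ N) φ - φ 0) := by
  have hc := hp.pos
  induction N with
  | zero => simp [chainLaw, expect_pure]
  | succ N ih =>
    rw [Finset.sum_range_succ, ih, expect_chainLaw_succ]
    field_simp
    ring

/-- The rate of matches between servers of type `i` and customers of type `j`. -/
def matchRate (p : PricingPolicy n m) (σ : MatchingPolicy Q) (i : Fin n) (j : Fin m)
    (q : State n m) : ℝ :=
  ∑ a, p.rate q a * expect (σ.choose q a) (fun x => (x i j : ℝ))

theorem matchRate_nonneg (hp : Uniformizable p c) (σ : MatchingPolicy Q) (i : Fin n) (j : Fin m)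
    (q : State n m) : 0 ≤ matchRate p σ i j q :=
  Finset.sum_nonneg fun a _ => mul_nonneg (hp.rate_nonneg q a) <|
    tsum_nonneg fun _ => mul_nonneg ENNReal.toReal_nonneg (Nat.cast_nonneg _)

theorem matchRate_of_not_compat (σ : MatchingPolicy Q) {i : Fin n} {j : Fin m}
    (h : ¬ Q.compat i j) (q : State n m) : matchRate p σ i j q = 0 := by
  refine Finset.sum_eq_zero fun a _ => ?_
  rw [expect_congr (σ.support_finite q a) (ψ := fun _ => 0)
    fun x hx => by simp [(σ.feasible q a x hx).compat i j h]]
  simp [expect]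

/-- Flow balance: arrivals minus departures by matching. Averaged over time, it turns match rates
into a flow. -/
theorem generator_customers (σ : MatchingPolicy Q) (j : Fin m) (q : State n m) :
    generator p σ (fun q => (q.2 j : ℝ)) q = p.lam q j - ∑ i, matchRate p σ i j q := by
  have h : ∀ a, expect (σ.choose q a)
      (fun x => ((((q.add a).remove x).2 j : ℕ) : ℝ) - (q.2 j : ℝ)) =
      (((q.add a).2 j : ℝ) - q.2 j) - ∑ i, expect (σ.choose q a) (fun x => (x i j : ℝ)) := by
    intro a
    have hs := σ.support_finite q a
    rw [expect_congr hs (ψ := fun x => (((q.add a).2 j : ℝ) - q.2 j) - ∑ i, (x i j : ℝ)),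
      expect_sub hs, expect_const hs, expect_sum hs]
    intro x hx
    simp only [State.remove]
    rw [Nat.cast_sub ((σ.feasible q a x hx).customers j)]
    push_cast
    ring
  simp only [generator, h, matchRate, mul_sub, Finset.sum_sub_distrib, Finset.mul_sum]
  rw [Finset.sum_comm (s := Finset.univ (α := Fin n))]
  congr 1
  rw [← Finset.sum_sub_distrib, Fintype.sum_sum_type]
  simp only [State.add, PricingPolicy.rate, sub_self, Finset.sum_const_zero, zero_add]
  rw [Finset.sum_eq_single j]
  · simp
    ring
  · intro b _ hb
    simp [Function.update_of_ne hb.symm]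
  · simp

theorem generator_servers (σ : MatchingPolicy Q) (i : Fin n) (q : State n m) :
    generator p σ (fun q => (q.1 i : ℝ)) q = p.mu q i - ∑ j, matchRate p σ i j q := by
  have h : ∀ a, expect (σ.choose q a)
      (fun x => ((((q.add a).remove x).1 i : ℕ) : ℝ) - (q.1 i : ℝ)) =
      (((q.add a).1 i : ℝ) - q.1 i) - ∑ j, expect (σ.choose q a) (fun x => (x i j : ℝ)) := by
    intro a
    have hs := σ.support_finite q a
    rw [expect_congr hs (ψ := fun x => (((q.add a).1 i : ℝ) - q.1 i) - ∑ j, (x i j : ℝ)),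
      expect_sub hs, expect_const hs, expect_sum hs]
    intro x hx
    simp only [State.remove]
    rw [Nat.cast_sub ((σ.feasible q a x hx).servers i)]
    push_cast
    ring
  simp only [generator, h, matchRate, mul_sub, Finset.sum_sub_distrib, Finset.mul_sum]
  rw [Finset.sum_comm (s := Finset.univ (α := Fin m))]
  congr 1
  rw [← Finset.sum_sub_distrib, Fintype.sum_sum_type]
  simp only [State.add, PricingPolicy.rate, sub_self, Finset.sum_const_zero, add_zero]
  rw [Finset.sum_eq_single i]
  · simp
    ring
  · intro b _ hb
    simp [Function.update_of_ne hb.symm]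
  · simp

/-- Customers minus servers; a match does not change it. -/
def imbalance (q : State n m) : ℝ := ∑ j, (q.2 j : ℝ) - ∑ i, (q.1 i : ℝ)

theorem abs_imbalance_le (q : State n m) : |imbalance q| ≤ q.total := by
  have h1 : (0 : ℝ) ≤ ∑ j, (q.2 j : ℝ) := by positivity
  have h2 : (0 : ℝ) ≤ ∑ i, (q.1 i : ℝ) := by positivity
  simp only [imbalance, State.total]
  push_cast
  rw [abs_le]
  constructor <;> linarith

theorem imbalance_remove {q : State n m} {x : Fin n → Fin m → ℕ} (hx : Q.Matchable q x) :
    imbalance (q.remove x) = imbalance q := by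
  simp only [imbalance, State.remove]
  simp only [Nat.cast_sub (hx.customers _), Nat.cast_sub (hx.servers _), Finset.sum_sub_distrib]
  push_cast
  rw [Finset.sum_comm (s := Finset.univ (α := Fin m))]
  ring

theorem imbalance_add_inl (q : State n m) (i : Fin n) :
    imbalance (q.add (Sum.inl i)) = imbalance q - 1 := by
  have : ∑ k, ((Function.update q.1 i (q.1 i + 1) k : ℕ) : ℝ) = ∑ k, (q.1 k : ℝ) + 1 := by
    rw [← Finset.add_sum_erase _ _ (Finset.mem_univ i),
      ← Finset.add_sum_erase _ (fun k => (q.1 k : ℝ)) (Finset.mem_univ i),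
      Finset.sum_congr rfl fun k hk => by
        rw [Function.update_of_ne (Finset.ne_of_mem_erase hk)]]
    simp
    ring
  simp only [imbalance, State.add, this]
  ring

theorem imbalance_add_inr (q : State n m) (j : Fin m) :
    imbalance (q.add (Sum.inr j)) = imbalance q + 1 := by
  have : ∑ k, ((Function.update q.2 j (q.2 j + 1) k : ℕ) : ℝ) = ∑ k, (q.2 k : ℝ) + 1 := by
    rw [← Finset.add_sum_erase _ _ (Finset.mem_univ j),
      ← Finset.add_sum_erase _ (fun k => (q.2 k : ℝ)) (Finset.mem_univ j),
      Finset.sum_congr rfl fun k hk => by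
        rw [Function.update_of_ne (Finset.ne_of_mem_erase hk)]]
    simp
    ring
  simp only [imbalance, State.add, this]
  ring

/-- The matching policy drops out, since a match removes one agent from each side; only the
aggregate arrival rates remain. -/
theorem generator_imbalance (σ : MatchingPolicy Q) (h : ℝ → ℝ) (q : State n m) :
    generator p σ (fun q => h (imbalance q)) q =
      (∑ j, p.lam q j) * (h (imbalance q + 1) - h (imbalance q)) +
        (∑ i, p.mu q i) * (h (imbalance q - 1) - h (imbalance q)) := by
  have hx : ∀ a, expect (σ.choose q a)
      (fun x => h (imbalance ((q.add a).remove x)) - h (imbalance q)) =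
      h (imbalance (q.add a)) - h (imbalance q) := by
    intro a
    rw [expect_congr (σ.support_finite q a)
      fun x hx => by rw [imbalance_remove (σ.feasible q a x hx)],
      expect_const (σ.support_finite q a)]
  simp only [generator, hx, Fintype.sum_sum_type, PricingPolicy.rate, imbalance_add_inl,
    imbalance_add_inr, ← Finset.sum_mul]
  ring

/-- The addition formulas separate the diffusive part (sum of the rates) from the drift part (their
difference). -/
theorem generator_cos (σ : MatchingPolicy Q) (θ : ℝ) (q : State n m) :
    generator p σ (fun q => -Real.cos (θ * imbalance q)) q =
      (∑ j, p.lam q j + ∑ i, p.mu q i) * (1 - Real.cos θ) * Real.cos (θ * imbalance q) +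
        (∑ j, p.lam q j - ∑ i, p.mu q i) * Real.sin θ * Real.sin (θ * imbalance q) := by
  rw [generator_imbalance σ (fun z => -Real.cos (θ * z))]
  simp only [mul_add, mul_sub, mul_one, Real.cos_add, Real.cos_sub]
  ring

end Chain

/-! ### Quadratic upper bound for concave functions -/

open Filter Topology Asymptotics

/-- A concave function with negative second derivative at `x₀` lies below its tangent by a
multiple of the squared distance, on bounded parts of its domain. -/
theorem exists_quadratic_bound {D : Set ℝ} (hD : IsRateDomain D) {r : ℝ → ℝ}
    (hr : ContDiffOn ℝ 2 r D) (hconc : ConcaveOn ℝ D r) {x₀ : ℝ} (hx₀ : x₀ ∈ D)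
    (h2 : iteratedDerivWithin 2 r D x₀ < 0) {B : ℝ} (hB : 0 < B) :
    ∃ a > 0, ∀ x, |x - x₀| ≤ B → x ∈ D →
      r x ≤ r x₀ + derivWithin r D x₀ * (x - x₀) - a * (x - x₀) ^ 2 := by
  set d := derivWithin r D x₀
  set b := iteratedDerivWithin 2 r D x₀ with hb
  have hT : ∀ x, taylorWithinEval r 2 D x₀ x = r x₀ + d * (x - x₀) + b / 2 * (x - x₀) ^ 2 := by
    intro x
    rw [taylorWithinEval_succ, taylorWithinEval_succ, taylor_within_zero_eval]
    simp only [smul_eq_mul, ← hb]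
    norm_num
    ring
  -- The Taylor coefficient is `b / 2`; allowing an error of `-b / 4` leaves half of the curvature.
  have ho := (taylor_isLittleO hD.convex hx₀ (n := 2) (by exact_mod_cast hr)).def
    (show (0 : ℝ) < -b / 4 by linarith)
  obtain ⟨ε, hε, hball⟩ := Metric.mem_nhdsWithin_iff.1 ho
  set ρ := ε / 2 with hρ
  have hρ0 : 0 < ρ := by positivity
  have hloc : ∀ x ∈ D, |x - x₀| ≤ ρ → r x ≤ r x₀ + d * (x - x₀) - (-b / 4) * (x - x₀) ^ 2 := by
    intro x hx hxρ
    have hmem : x ∈ Metric.ball x₀ ε ∩ D := by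
      refine ⟨?_, hx⟩
      rw [Metric.mem_ball, Real.dist_eq]
      linarith
    have h := hball hmem
    simp only [Set.mem_ofPred_eq, hT, Real.norm_eq_abs, abs_pow, sq_abs] at h
    have := (abs_le.1 h).2
    linarith
  have hb4 : 0 < -b / 4 := by linarith
  refine ⟨-b / 4 * min 1 (ρ / B), by positivity, fun x hxB hx => ?_⟩
  by_cases hxρ : |x - x₀| ≤ ρ
  · have h1 : -b / 4 * min 1 (ρ / B) * (x - x₀) ^ 2 ≤ -b / 4 * 1 * (x - x₀) ^ 2 := by
      gcongr
      exact min_le_left _ _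
    have := hloc x hx hxρ
    linarith
  · push Not at hxρ
    have hy : 0 < |x - x₀| := hρ0.trans hxρ
    -- A far point is pulled back along the chord to `y` at distance exactly `ρ`. Concavity bounds
    -- `r y` below by the chord, the local bound bounds it above, and division by `t ≥ ρ / B` leaves
    -- curvature `-b / 4 * t`.
    set t := ρ / |x - x₀| with ht
    have ht0 : 0 < t := by positivity
    have ht1 : t ≤ 1 := (div_le_one hy).2 hxρ.le
    have hc := hconc.2 hx₀ hx (sub_nonneg.2 ht1) ht0.le (by ring)
    have hm := hD.convex hx₀ hx (sub_nonneg.2 ht1) ht0.le (by ring)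
    simp only [smul_eq_mul] at hc hm
    set y := (1 - t) * x₀ + t * x with hydef
    have hyx : y - x₀ = t * (x - x₀) := by rw [hydef]; ring
    have hl := hloc y hm (by
      rw [hyx, abs_mul, abs_of_pos ht0, ht, div_mul_cancel₀ _ hy.ne'])
    rw [hyx] at hl
    have hkey : t * (r x - r x₀ - d * (x - x₀)) ≤ t * (-(-b / 4 * t * (x - x₀) ^ 2)) := by
      nlinarith
    have h3 := le_of_mul_le_mul_left hkey ht0
    have h4 : -b / 4 * min 1 (ρ / B) * (x - x₀) ^ 2 ≤ -b / 4 * t * (x - x₀) ^ 2 := by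
      gcongr
      exact (min_le_right _ _).trans (by rw [ht]; gcongr)
    linarith

/-! ### The fluid problem -/

section Fluid

variable {n m : ℕ} {Q : TwoSidedQueue n m}

namespace TwoSidedQueue

theorem Regular.revenue_contDiff (hQ : Q.Regular) (j : Fin m) :
    ContDiffOn ℝ 2 (Q.revenue j) (Q.demandDom j) :=
  contDiffOn_id.mul (hQ.demand_contDiff j)

theorem Regular.cost_contDiff (hQ : Q.Regular) (i : Fin n) :
    ContDiffOn ℝ 2 (Q.cost i) (Q.supplyDom i) :=
  contDiffOn_id.mul (hQ.supply_contDiff i)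

/-- Marginal revenue. -/
def marginalRevenue (Q : TwoSidedQueue n m) (j : Fin m) (x : ℝ) : ℝ :=
  derivWithin (Q.revenue j) (Q.demandDom j) x

/-- Marginal cost. -/
def marginalCost (Q : TwoSidedQueue n m) (i : Fin n) (x : ℝ) : ℝ :=
  derivWithin (Q.cost i) (Q.supplyDom i) x

theorem revenue_scale (Q : TwoSidedQueue n m) {R : ℝ} (hR : 0 < R) (j : Fin m) (x : ℝ) :
    (Q.scale R).revenue j x = R * Q.revenue j (x / R) := by
  simp only [revenue, scale]
  field_simp

theorem cost_scale (Q : TwoSidedQueue n m) {R : ℝ} (hR : 0 < R) (i : Fin n) (x : ℝ) :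
    (Q.scale R).cost i x = R * Q.cost i (x / R) := by
  simp only [cost, scale]
  field_simp

/-- Division by `R` maps feasible points of the scaled problem to those of the original. Optimality
thus also shows that the supremum is over a bounded set, without which `sSup` would carry no
information. -/
theorem FluidOptimal.le_fluidValue_scale {lam : Fin m → ℝ} {mu : Fin n → ℝ}
    (h : Q.FluidOptimal lam mu) {R : ℝ} (hR : 0 < R) :
    R * Q.fluidObjective lam mu ≤ (Q.scale R).fluidValue := by
  have hobj : ∀ l u, (Q.scale R).fluidObjective l u =
      R * Q.fluidObjective (fun j => l j / R) (fun i => u i / R) := by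
    intro l u
    simp only [fluidObjective, revenue_scale Q hR, cost_scale Q hR, mul_sub, Finset.mul_sum]
  refine le_csSup ⟨R * Q.fluidObjective lam mu, ?_⟩ ?_
  · rintro v ⟨l, u, χ, hf, rfl⟩
    rw [hobj]
    refine mul_le_mul_of_nonneg_left (h.2 _ _ (fun i j => χ i j / R) ?_) hR.le
    exact
      { lam_mem := hf.lam_mem
        mu_mem := hf.mu_mem
        lam_eq := fun j => by rw [hf.lam_eq, Finset.sum_div]
        mu_eq := fun i => by rw [hf.mu_eq, Finset.sum_div]
        chi_nonneg := fun i j => div_nonneg (hf.chi_nonneg i j) hR.le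
        chi_zero := fun i j hij => by rw [hf.chi_zero i j hij, zero_div] }
  · obtain ⟨χ, hf⟩ := h.1
    refine ⟨fun j => R * lam j, fun i => R * mu i, fun i j => R * χ i j, ?_, ?_⟩
    · exact
        { lam_mem := fun j => by
            simpa [scale, mul_div_cancel_left₀ _ hR.ne'] using hf.lam_mem j
          mu_mem := fun i => by
            simpa [scale, mul_div_cancel_left₀ _ hR.ne'] using hf.mu_mem i
          lam_eq := fun j => by rw [hf.lam_eq, Finset.mul_sum]
          mu_eq := fun i => by rw [hf.mu_eq, Finset.mul_sum]
          chi_nonneg := fun i j => mul_nonneg hR.le (hf.chi_nonneg i j)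
          chi_zero := fun i j hij => by
            have := hf.chi_zero i j hij
            simp [this] }
    · rw [hobj]
      simp [mul_div_cancel_left₀ _ hR.ne']

end TwoSidedQueue

/-- The half-open segment from a point of an interval to a point of its closure. -/
theorem segment_mem_of_mem_closure {D : Set ℝ} (hD : Convex ℝ D) {x y : ℝ} (hx : x ∈ D)
    (hy : y ∈ closure D) {t : ℝ} (ht0 : 0 ≤ t) (ht1 : t < 1) : x + t * (y - x) ∈ D := by
  have hO := hD.ordConnected
  rcases lt_trichotomy x y with h | h | h
  · have hlt : x + t * (y - x) < y := by nlinarith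
    obtain ⟨z, hz, hzD⟩ := mem_closure_iff.1 hy _ isOpen_Ioi (Set.mem_Ioi.2 hlt)
    exact hO.out hx hzD ⟨by nlinarith, le_of_lt hz⟩
  · simpa [h] using h ▸ hx
  · have hlt : y < x + t * (y - x) := by nlinarith
    obtain ⟨z, hz, hzD⟩ := mem_closure_iff.1 hy _ isOpen_Iio (Set.mem_Iio.2 hlt)
    exact hO.out hzD hx ⟨le_of_lt hz, by nlinarith⟩

/-- The derivative along a segment that starts at a point of an interval. -/
theorem tendsto_slope_segment {D : Set ℝ} (hD : Convex ℝ D) {r : ℝ → ℝ} {x y d : ℝ}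
    (hr : HasDerivWithinAt r d D x) (hx : x ∈ D) (hy : y ∈ closure D) :
    Tendsto (fun t : ℝ => (r (x + t * (y - x)) - r x) / t) (𝓝[>] 0) (𝓝 (d * (y - x))) := by
  have hline : HasDerivWithinAt (fun t : ℝ => x + t * (y - x)) (y - x) (Set.Ico 0 1) 0 := by
    simpa using (((hasDerivAt_id (0 : ℝ)).mul_const (y - x)).const_add x).hasDerivWithinAt
  have hmaps : Set.MapsTo (fun t : ℝ => x + t * (y - x)) (Set.Ico 0 1) D :=
    fun t ht => segment_mem_of_mem_closure hD hx hy ht.1 ht.2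
  have hcomp : HasDerivWithinAt (fun t : ℝ => r (x + t * (y - x))) (d * (y - x))
      (Set.Ico 0 1) 0 :=
    HasDerivWithinAt.comp (0 : ℝ) (h₂ := r) (by simpa using hr) hline hmaps
  have h := (hasDerivWithinAt_iff_tendsto_slope.1 hcomp).mono_left
    (nhdsWithin_mono 0 (s := Set.Ioo (0 : ℝ) 1) fun t ht => ⟨⟨ht.1.le, ht.2⟩, ht.1.ne'⟩)
  rw [nhdsWithin_Ioo_eq_nhdsGT zero_lt_one] at h
  refine h.congr fun t => ?_
  simp [slope_def_field]

/-- First-order optimality in the fluid problem, with the domains closed up. -/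
theorem TwoSidedQueue.FluidOptimal.first_order (hQ : Q.Regular) {lam : Fin m → ℝ}
    {mu : Fin n → ℝ} (h : Q.FluidOptimal lam mu) {χ' : Fin n → Fin m → ℝ}
    (hnonneg : ∀ i j, 0 ≤ χ' i j) (hzero : ∀ i j, ¬ Q.compat i j → χ' i j = 0)
    (hlam : ∀ j, ∑ i, χ' i j ∈ closure (Q.demandDom j))
    (hmu : ∀ i, ∑ j, χ' i j ∈ closure (Q.supplyDom i)) :
    ∑ j, Q.marginalRevenue j (lam j) * (∑ i, χ' i j - lam j) -
      ∑ i, Q.marginalCost i (mu i) * (∑ j, χ' i j - mu i) ≤ 0 := by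
  obtain ⟨χ, hf⟩ := h.1
  have hr : ∀ j, HasDerivWithinAt (Q.revenue j) (Q.marginalRevenue j (lam j)) (Q.demandDom j)
      (lam j) := fun j =>
    (((hQ.revenue_contDiff j).differentiableOn (by norm_num)) _ (hf.lam_mem j)).hasDerivWithinAt
  have hc : ∀ i, HasDerivWithinAt (Q.cost i) (Q.marginalCost i (mu i)) (Q.supplyDom i)
      (mu i) := fun i =>
    (((hQ.cost_contDiff i).differentiableOn (by norm_num)) _ (hf.mu_mem i)).hasDerivWithinAt
  have hlim := (tendsto_finsetSum Finset.univ fun j _ =>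
      tendsto_slope_segment (hQ.demandDom j).convex (hr j) (hf.lam_mem j) (hlam j)).sub
    (tendsto_finsetSum Finset.univ fun i _ =>
      tendsto_slope_segment (hQ.supplyDom i).convex (hc i) (hf.mu_mem i) (hmu i))
  -- For `t` in `(0, 1)` the mixture of the optimal flow with `χ'` is feasible even if the rates of
  -- `χ'` only lie in the closures, so every difference quotient of the objective is nonpositive.
  refine le_of_tendsto hlim ?_
  filter_upwards [Ioo_mem_nhdsGT (zero_lt_one (α := ℝ))] with t ht
  have hopt := h.2 (fun j => lam j + t * (∑ i, χ' i j - lam j))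
    (fun i => mu i + t * (∑ j, χ' i j - mu i))
    (fun i j => χ i j + t * (χ' i j - χ i j))
    { lam_mem := fun j => segment_mem_of_mem_closure (hQ.demandDom j).convex (hf.lam_mem j)
        (hlam j) ht.1.le ht.2
      mu_mem := fun i => segment_mem_of_mem_closure (hQ.supplyDom i).convex (hf.mu_mem i)
        (hmu i) ht.1.le ht.2
      lam_eq := fun j => by
        simp only [hf.lam_eq, Finset.sum_add_distrib, ← Finset.mul_sum, Finset.sum_sub_distrib]
      mu_eq := fun i => by
        simp only [hf.mu_eq, Finset.sum_add_distrib, ← Finset.mul_sum, Finset.sum_sub_distrib]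
      chi_nonneg := fun i j => by
        nlinarith [mul_nonneg ht.1.le (hnonneg i j),
          mul_nonneg (sub_nonneg.2 ht.2.le) (hf.chi_nonneg i j)]
      chi_zero := fun i j hij => by rw [hf.chi_zero i j hij, hzero i j hij]; ring }
  simp only [TwoSidedQueue.fluidObjective] at hopt
  rw [← Finset.sum_div, ← Finset.sum_div, ← sub_div]
  refine div_nonpos_of_nonpos_of_nonneg ?_ ht.1.le
  simp only [Finset.sum_sub_distrib]
  linarith

/-- The profit lost to a deviation of the rates from the fluid optimum is at least quadratic. -/
theorem TwoSidedQueue.Regular.exists_quadratic_loss (hQ : Q.Regular) {lam : Fin m → ℝ}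
    {mu : Fin n → ℝ} (hlam : ∀ j, lam j ∈ Q.demandDom j) (hmu : ∀ i, mu i ∈ Q.supplyDom i)
    (hrevenue : ∀ j, iteratedDerivWithin 2 (Q.revenue j) (Q.demandDom j) (lam j) < 0)
    (hcost : ∀ i, 0 < iteratedDerivWithin 2 (Q.cost i) (Q.supplyDom i) (mu i))
    {B : ℝ} (hB : 0 < B) :
    ∃ a > 0,
      (∀ j x, |x - lam j| ≤ B → x ∈ Q.demandDom j → Q.revenue j x ≤
        Q.revenue j (lam j) + Q.marginalRevenue j (lam j) * (x - lam j) -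
          a * (x - lam j) ^ 2) ∧
      (∀ i x, |x - mu i| ≤ B → x ∈ Q.supplyDom i →
        Q.cost i (mu i) + Q.marginalCost i (mu i) * (x - mu i) + a * (x - mu i) ^ 2 ≤
          Q.cost i x) := by
  have hr := fun j => exists_quadratic_bound (hQ.demandDom j) (hQ.revenue_contDiff j)
    (hQ.revenue_concave j) (hlam j) (hrevenue j) hB
  have hc := fun i => exists_quadratic_bound (hQ.supplyDom i) (r := -Q.cost i)
    (hQ.cost_contDiff i).neg (hQ.cost_convex i).neg (hmu i)
    (by
      rw [iteratedDerivWithin_neg]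
      simpa using hcost i) hB
  choose a ha har using hr
  choose b hb hbc using hc
  -- A sufficiently small `e` serves as common lower bound, also when there are no types on one
  -- side.
  have hmin : ∃ e > 0, (∀ j, e ≤ a j) ∧ ∀ i, e ≤ b i := by
    have hmem : ∀ᶠ e in 𝓝[>] (0 : ℝ), (∀ j, e ≤ a j) ∧ ∀ i, e ≤ b i :=
      (eventually_all.2 fun j => mem_of_superset (Ioo_mem_nhdsGT (ha j)) fun e he => he.2.le).and
        (eventually_all.2 fun i => mem_of_superset (Ioo_mem_nhdsGT (hb i)) fun e he => he.2.le)
    obtain ⟨e, he, he0⟩ := (hmem.and self_mem_nhdsWithin).exists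
    exact ⟨e, he0, he⟩
  obtain ⟨e, he0, hea, heb⟩ := hmin
  refine ⟨e, he0, fun j x hx hxD => ?_, fun i x hx hxD => ?_⟩
  · have := har j x hx hxD
    have h2 := mul_le_mul_of_nonneg_right (hea j) (sq_nonneg (x - lam j))
    rw [TwoSidedQueue.marginalRevenue]
    linarith
  · have := hbc i x hx hxD
    have h2 := mul_le_mul_of_nonneg_right (heb i) (sq_nonneg (x - mu i))
    have h3 : derivWithin (-Q.cost i) (Q.supplyDom i) (mu i) =
        -derivWithin (Q.cost i) (Q.supplyDom i) (mu i) := derivWithin.neg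
    rw [h3] at this
    simp only [Pi.neg_apply] at this
    rw [TwoSidedQueue.marginalCost]
    linarith

end Fluid

/-! ### Time averages and the limiting matching flow -/

section Average

variable {n m : ℕ} {Q : TwoSidedQueue n m} {p : PricingPolicy n m} {c : ℝ}

/-- The expected average of `φ` over the first `N` steps from the empty system. -/
def average (hp : Uniformizable p c) (σ : MatchingPolicy Q) (N : ℕ) (φ : State n m → ℝ) : ℝ :=
  (∑ k ∈ Finset.range N, expect (chainLaw hp σ k) φ) / N

variable (hp : Uniformizable p c) (σ : MatchingPolicy Q) (N : ℕ)

theorem average_mono {φ ψ : State n m → ℝ} (h : ∀ q, φ q ≤ ψ q) :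
    average hp σ N φ ≤ average hp σ N ψ :=
  div_le_div_of_nonneg_right (Finset.sum_le_sum fun k _ =>
    expect_mono (chainLaw_support_finite hp σ k) fun q _ => h q) (Nat.cast_nonneg N)

theorem average_add (φ ψ : State n m → ℝ) :
    average hp σ N (fun q => φ q + ψ q) = average hp σ N φ + average hp σ N ψ := by
  simp only [average, expect_add (chainLaw_support_finite hp σ _), Finset.sum_add_distrib, add_div]

theorem average_sub (φ ψ : State n m → ℝ) :
    average hp σ N (fun q => φ q - ψ q) = average hp σ N φ - average hp σ N ψ := by
  simp only [average, expect_sub (chainLaw_support_finite hp σ _), Finset.sum_sub_distrib, sub_div]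

theorem average_mul_left (r : ℝ) (φ : State n m → ℝ) :
    average hp σ N (fun q => r * φ q) = r * average hp σ N φ := by
  simp only [average, expect_mul_left, ← Finset.mul_sum, mul_div_assoc]

theorem average_sum {κ : Type*} (s : Finset κ) (φ : κ → State n m → ℝ) :
    average hp σ N (fun q => ∑ k ∈ s, φ k q) = ∑ k ∈ s, average hp σ N (φ k) := by
  simp only [average, expect_sum (chainLaw_support_finite hp σ _)]
  rw [Finset.sum_comm, Finset.sum_div]

theorem average_const {N : ℕ} (hN : 0 < N) (r : ℝ) : average hp σ N (fun _ => r) = r := by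
  have : (N : ℝ) ≠ 0 := by positivity
  simp only [average, expect_const (chainLaw_support_finite hp σ _), Finset.sum_const,
    Finset.card_range, nsmul_eq_mul]
  field_simp

theorem average_generator (φ : State n m → ℝ) :
    average hp σ N (generator p σ φ) = c * (expect (chainLaw hp σ N) φ - φ 0) / N := by
  rw [average, sum_expect_generator]

theorem average_nonneg {φ : State n m → ℝ} (h : ∀ q, 0 ≤ φ q) : 0 ≤ average hp σ N φ :=
  div_nonneg (Finset.sum_nonneg fun _ _ => tsum_nonneg fun q =>
    mul_nonneg ENNReal.toReal_nonneg (h q)) (Nat.cast_nonneg N)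

theorem average_lam_sub (j : Fin m) :
    average hp σ N (fun q => p.lam q j) - ∑ i, average hp σ N (matchRate p σ i j) =
      c * (expect (chainLaw hp σ N) (fun q => (q.2 j : ℝ)) / N) := by
  rw [← average_sum, ← average_sub, ← funext (generator_customers σ j), average_generator]
  simp
  ring

theorem average_mu_sub (i : Fin n) :
    average hp σ N (fun q => p.mu q i) - ∑ j, average hp σ N (matchRate p σ i j) =
      c * (expect (chainLaw hp σ N) (fun q => (q.1 i : ℝ)) / N) := by
  rw [← average_sum, ← average_sub, ← funext (generator_servers σ i), average_generator]
  simp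
  ring

theorem lam_le (hp : Uniformizable p c) (j : Fin m) (q : State n m) : p.lam q j ≤ c :=
  (Finset.single_le_sum (f := p.rate q) (fun a _ => hp.rate_nonneg q a)
    (Finset.mem_univ (Sum.inr j))).trans (hp.totalRate_le q)

theorem expect_nonneg {ι : Type*} {p : PMF ι} {φ : ι → ℝ} (h : ∀ a, 0 ≤ φ a) :
    0 ≤ expect p φ :=
  tsum_nonneg fun a => mul_nonneg ENNReal.toReal_nonneg (h a)

/-- Matches cannot outnumber arrivals on average. This confines the average match rates to a compact
box. -/
theorem average_matchRate_le {N : ℕ} (hN : 0 < N) (i : Fin n) (j : Fin m) :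
    average hp σ N (matchRate p σ i j) ≤ c := by
  have h1 : average hp σ N (matchRate p σ i j) ≤ ∑ i, average hp σ N (matchRate p σ i j) :=
    Finset.single_le_sum (f := fun i => average hp σ N (matchRate p σ i j))
      (fun i _ => average_nonneg hp σ N (matchRate_nonneg hp σ i j)) (Finset.mem_univ i)
  have h2 := average_lam_sub hp σ N j
  have h3 : average hp σ N (fun q => p.lam q j) ≤ c :=
    (average_mono hp σ N (lam_le hp j)).trans_eq (average_const hp σ hN c)
  have h4 : 0 ≤ c * (expect (chainLaw hp σ N) (fun q => (q.2 j : ℝ)) / N) :=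
    mul_nonneg hp.pos.le (div_nonneg (expect_nonneg fun q => Nat.cast_nonneg _) (Nat.cast_nonneg _))
  linarith

/-- The expected number of waiting agents grows by at most one per step. -/
theorem expect_total_succ_le (k : ℕ) :
    expect (chainLaw hp σ (k + 1)) (fun q => (q.total : ℝ)) ≤
      expect (chainLaw hp σ k) (fun q => (q.total : ℝ)) + 1 := by
  have hc := hp.pos
  have hs := chainLaw_support_finite hp σ
  have htot : ∀ k, expect (chainLaw hp σ k) (fun q => (q.total : ℝ)) =
      ∑ i, expect (chainLaw hp σ k) (fun q => (q.1 i : ℝ)) +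
        ∑ j, expect (chainLaw hp σ k) (fun q => (q.2 j : ℝ)) := by
    intro k
    rw [← expect_sum (hs k), ← expect_sum (hs k), ← expect_add (hs k)]
    simp [State.total]
  have h1 : ∀ i, expect (chainLaw hp σ k) (generator p σ fun q => (q.1 i : ℝ)) ≤
      expect (chainLaw hp σ k) (fun q => p.mu q i) := fun i =>
    expect_mono (hs k) fun q _ => by
      rw [generator_servers]
      linarith [Finset.sum_nonneg fun j (_ : j ∈ Finset.univ) => matchRate_nonneg hp σ i j q]
  have h2 : ∀ j, expect (chainLaw hp σ k) (generator p σ fun q => (q.2 j : ℝ)) ≤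
      expect (chainLaw hp σ k) (fun q => p.lam q j) := fun j =>
    expect_mono (hs k) fun q _ => by
      rw [generator_customers]
      linarith [Finset.sum_nonneg fun i (_ : i ∈ Finset.univ) => matchRate_nonneg hp σ i j q]
  have h3 : ∑ i, expect (chainLaw hp σ k) (fun q => p.mu q i) +
      ∑ j, expect (chainLaw hp σ k) (fun q => p.lam q j) ≤ c := by
    rw [← expect_sum (hs k), ← expect_sum (hs k), ← expect_add (hs k)]
    refine (expect_mono (hs k) fun q _ => ?_).trans_eq (expect_const (hs k) c)
    have := hp.totalRate_le q
    rwa [PricingPolicy.totalRate, Fintype.sum_sum_type] at this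
  have h4 := Finset.sum_le_sum fun i (_ : i ∈ Finset.univ) => h1 i
  have h5 := Finset.sum_le_sum fun j (_ : j ∈ Finset.univ) => h2 j
  rw [htot, htot]
  simp only [expect_chainLaw_succ, Finset.sum_add_distrib, ← Finset.sum_div]
  have h6 : (∑ i, expect (chainLaw hp σ k) (generator p σ fun q => (q.1 i : ℝ))) / c +
      (∑ j, expect (chainLaw hp σ k) (generator p σ fun q => (q.2 j : ℝ))) / c ≤ 1 := by
    rw [← add_div, div_le_one hc]
    linarith
  linarith

/-- Squaring `x (k + 1) ≤ x k + 1` and telescoping: a large final mean queue needs a long build-up,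
which a bounded average forbids. -/
theorem sq_expect_total_le :
    (expect (chainLaw hp σ N) (fun q => (q.total : ℝ))) ^ 2 ≤
      2 * ∑ k ∈ Finset.range N, expect (chainLaw hp σ k) (fun q => (q.total : ℝ)) + N := by
  induction N with
  | zero => simp [chainLaw, expect_pure, State.total]
  | succ N ih =>
    have h0 : 0 ≤ expect (chainLaw hp σ (N + 1)) (fun q => (q.total : ℝ)) :=
      expect_nonneg fun q => Nat.cast_nonneg _
    have h1 := expect_total_succ_le hp σ N
    rw [Finset.sum_range_succ]
    push_cast
    nlinarith

/-- If the average number of waiting agents is bounded along a sequence of horizons, then the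
expected number of waiting agents is sublinear along it. -/
theorem tendsto_expect_total_div {ν : ℕ → ℕ} (hν : Tendsto ν atTop atTop) {b : ℝ}
    (hb : ∀ k, average hp σ (ν k) (fun q => (q.total : ℝ)) ≤ b) :
    Tendsto (fun k => expect (chainLaw hp σ (ν k)) (fun q => (q.total : ℝ)) / ν k) atTop
      (𝓝 0) := by
  have hlim : Tendsto (fun k => √((2 * b + 1) / (ν k : ℝ))) atTop (𝓝 0) := by
    have := ((tendsto_const_div_atTop_nhds_zero_nat (2 * b + 1)).comp hν).sqrt
    simpa using this
  refine squeeze_zero' (Eventually.of_forall fun k => div_nonneg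
    (expect_nonneg fun q => Nat.cast_nonneg _) (Nat.cast_nonneg _)) ?_ hlim
  filter_upwards [hν.eventually_gt_atTop 0] with k hk
  have hk' : (0 : ℝ) < ν k := by exact_mod_cast hk
  refine Real.le_sqrt_of_sq_le ?_
  have h1 := sq_expect_total_le hp σ (ν k)
  have h2 := hb k
  rw [average, div_le_iff₀ hk'] at h2
  rw [div_pow, div_le_div_iff₀ (by positivity) hk']
  nlinarith

/-- Limits of the averages of the matching rates along horizons with bounded average queues: the
arrival rates converge to those of a matching flow. -/
theorem exists_limit_flow {ν : ℕ → ℕ} (hν : StrictMono ν) {b : ℝ}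
    (hb : ∀ k, average hp σ (ν k) (fun q => (q.total : ℝ)) ≤ b) :
    ∃ (φ : ℕ → ℕ) (χ : Fin n → Fin m → ℝ), StrictMono φ ∧ (∀ i j, 0 ≤ χ i j) ∧
      (∀ i j, ¬ Q.compat i j → χ i j = 0) ∧
      (∀ j, Tendsto (fun k => average hp σ (ν (φ k)) fun q => p.lam q j) atTop
        (𝓝 (∑ i, χ i j))) ∧
      ∀ i, Tendsto (fun k => average hp σ (ν (φ k)) fun q => p.mu q i) atTop
        (𝓝 (∑ j, χ i j)) := by
  -- `ν 0` may be `0`, and averages over an empty horizon are useless; hence the shift by one.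
  have hpos : ∀ k, 0 < ν (k + 1) := fun k => (Nat.zero_le _).trans_lt (hν (Nat.lt_succ_self k))
  obtain ⟨χ, -, φ, hφ, hlim⟩ := (isCompact_Icc (a := (0 : Fin n → Fin m → ℝ))
    (b := fun _ _ => c)).tendsto_subseq
    (x := fun k i j => average hp σ (ν (k + 1)) (matchRate p σ i j))
    (fun k => ⟨fun i j => average_nonneg hp σ _ (matchRate_nonneg hp σ i j),
      fun i j => average_matchRate_le hp σ (hpos k) i j⟩)
  have hχ : ∀ i j, Tendsto (fun k => average hp σ (ν (φ k + 1)) (matchRate p σ i j)) atTop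
      (𝓝 (χ i j)) := fun i j => ((tendsto_pi_nhds.1 ((tendsto_pi_nhds.1 hlim) i)) j)
  have hφ' : StrictMono fun k => φ k + 1 := fun a b hab => Nat.succ_lt_succ (hφ hab)
  have htot := tendsto_expect_total_div hp σ (ν := fun k => ν (φ k + 1))
    (hν.comp hφ').tendsto_atTop fun k => hb _
  -- The defect in flow balance is `c` times a queue length over the horizon, hence vanishes.
  have hsmall : ∀ ψ : State n m → ℝ, (∀ q, 0 ≤ ψ q) → (∀ q, ψ q ≤ q.total) →
      Tendsto (fun k => c * (expect (chainLaw hp σ (ν (φ k + 1))) ψ / ν (φ k + 1))) atTop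
        (𝓝 0) := by
    intro ψ h0 h1
    rw [← mul_zero c]
    refine (squeeze_zero (fun k => div_nonneg (expect_nonneg h0) (Nat.cast_nonneg _))
      (fun k => ?_) htot).const_mul c
    exact div_le_div_of_nonneg_right
      (expect_mono (chainLaw_support_finite hp σ _) fun q _ => h1 q) (Nat.cast_nonneg _)
  refine ⟨fun k => φ k + 1, χ, hφ', fun i j => ge_of_tendsto' (hχ i j) fun k =>
    average_nonneg hp σ _ (matchRate_nonneg hp σ i j), fun i j hij => ?_, fun j => ?_,
    fun i => ?_⟩
  · refine tendsto_nhds_unique (hχ i j) ?_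
    have h0 : matchRate p σ i j = fun _ => 0 := funext (matchRate_of_not_compat σ hij)
    simp [h0, average, expect]
  · have h := (tendsto_finsetSum Finset.univ fun i _ => hχ i j).add
      (hsmall (fun q => (q.2 j : ℝ)) (fun q => Nat.cast_nonneg _) fun q => by
        have := Finset.single_le_sum (f := q.2) (fun _ _ => Nat.zero_le _) (Finset.mem_univ j)
        exact_mod_cast this.trans (Nat.le_add_left _ _))
    rw [add_zero] at h
    refine h.congr fun k => ?_
    rw [← average_lam_sub]
    ring
  · have h := (tendsto_finsetSum Finset.univ fun j _ => hχ i j).add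
      (hsmall (fun q => (q.1 i : ℝ)) (fun q => Nat.cast_nonneg _) fun q => by
        have := Finset.single_le_sum (f := q.1) (fun _ _ => Nat.zero_le _) (Finset.mem_univ i)
        exact_mod_cast this.trans (Nat.le_add_right _ _))
    rw [add_zero] at h
    refine h.congr fun k => ?_
    rw [← average_mu_sub]
    ring

end Average

/-! ### The trade-off between price variability and queue length -/

section Tradeoff

variable {n m : ℕ} {Q : TwoSidedQueue n m} {p : PricingPolicy n m}

theorem one_sub_abs_le_cos (x : ℝ) : 1 - |x| ≤ Real.cos x := by
  rcases le_total |x| 2 with h | h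
  · have := Real.one_sub_sq_div_two_le_cos (x := x)
    nlinarith [sq_abs x, abs_nonneg x]
  · linarith [Real.neg_one_le_cos x]

/-- The constant comes from `2 / π² ≥ 1 / 8`, that is, `π ≤ 4`. -/
theorem sq_div_eight_le_one_sub_cos {θ : ℝ} (h0 : 0 ≤ θ) (h1 : θ ≤ 1) :
    θ ^ 2 / 8 ≤ 1 - Real.cos θ := by
  have h := Real.cos_le_one_sub_mul_cos_sq (x := θ)
    (by rw [abs_of_nonneg h0]; linarith [Real.pi_gt_three])
  have hpi : (1 : ℝ) / 8 ≤ 2 / Real.pi ^ 2 := by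
    rw [div_le_div_iff₀ (by norm_num) (by positivity)]
    nlinarith [Real.pi_le_four, Real.pi_pos]
  nlinarith [mul_le_mul_of_nonneg_right hpi (sq_nonneg θ)]

/-- The imbalance diffuses at rate `L` unless the rates deviate from balance. -/
theorem generator_cos_ge (σ : MatchingPolicy Q) {L u v θ : ℝ} (hL : 0 ≤ L) (h0 : 0 ≤ θ)
    (h1 : θ ≤ 1) (q : State n m) (hu : ∑ j, p.lam q j = L + u) (hv : ∑ i, p.mu q i = L + v) :
    L * θ ^ 2 / 4 - L * θ ^ 3 * |imbalance q| - 2 * θ * (|u| + |v|) ≤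
      generator p σ (fun q => -Real.cos (θ * imbalance q)) q := by
  rw [generator_cos, hu, hv]
  set z := imbalance q
  have hc1 := sq_div_eight_le_one_sub_cos h0 h1
  have hc2 : 1 - Real.cos θ ≤ θ ^ 2 / 2 := by
    linarith [Real.one_sub_sq_div_two_le_cos (x := θ)]
  have hz := one_sub_abs_le_cos (θ * z)
  rw [abs_mul, abs_of_nonneg h0] at hz
  set C := 1 - Real.cos θ
  have hC0 : 0 ≤ C := le_trans (by positivity) hc1
  -- Thus the deviations in the diffusive part cost no more than those in the drift part, at most `θ
  -- * (|u| + |v|)` each.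
  have hCθ : C ≤ θ := by nlinarith
  have e1 : 2 * L * C * (1 - θ * |z|) ≤ 2 * L * C * Real.cos (θ * z) :=
    mul_le_mul_of_nonneg_left hz (by positivity)
  have e2 : L * (θ ^ 2 / 8) ≤ L * C := mul_le_mul_of_nonneg_left hc1 hL
  have e3 : L * C * (θ * |z|) ≤ L * (θ ^ 2 / 2) * (θ * |z|) := by gcongr
  have hs : |Real.sin θ| ≤ θ := by
    simpa [abs_of_nonneg h0] using Real.abs_sin_le_abs (x := θ)
  have e4 : |(u + v) * C * Real.cos (θ * z)| ≤ (|u| + |v|) * θ * 1 := by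
    rw [abs_mul, abs_mul, abs_of_nonneg hC0]
    gcongr
    · exact abs_add_le u v
    · exact Real.abs_cos_le_one _
  have e5 : |(u - v) * Real.sin θ * Real.sin (θ * z)| ≤ (|u| + |v|) * θ * 1 := by
    rw [abs_mul, abs_mul]
    gcongr
    · exact abs_sub u v
    · exact Real.abs_sin_le_one _
  have e6 := neg_abs_le ((u + v) * C * Real.cos (θ * z))
  have e7 := neg_abs_le ((u - v) * Real.sin θ * Real.sin (θ * z))
  have e8 : (L + u + (L + v)) * C * Real.cos (θ * z) + (L + u - (L + v)) * Real.sin θ *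
      Real.sin (θ * z) = 2 * L * C * Real.cos (θ * z) + (u + v) * C * Real.cos (θ * z) +
        (u - v) * Real.sin θ * Real.sin (θ * z) := by ring
  rw [e8]
  nlinarith

/-- Completing the square. -/
theorem neg_sq_le_sub_abs {a R A θ : ℝ} (ha : 0 < a) (hR : 0 < R) (x : ℝ) :
    -(A ^ 2 * θ ^ 2 * R / a) ≤ a * x ^ 2 / R - 2 * A * θ * |x| := by
  have h : a * x ^ 2 / R - 2 * A * θ * |x| + A ^ 2 * θ ^ 2 * R / a =
      a / R * (|x| - A * θ * R / a) ^ 2 := by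
    rw [← sq_abs x]
    field_simp
    ring
  have : 0 ≤ a / R * (|x| - A * θ * R / a) ^ 2 := by positivity
  linarith

/-- The profit rate under a deviation from the scaled fluid optimum. -/
theorem profitRate_le_quadratic {lam : Fin m → ℝ} {mu : Fin n → ℝ} {a B : ℝ}
    (hr : ∀ j x, |x - lam j| ≤ B → x ∈ Q.demandDom j → Q.revenue j x ≤
        Q.revenue j (lam j) + Q.marginalRevenue j (lam j) * (x - lam j) - a * (x - lam j) ^ 2)
    (hc : ∀ i x, |x - mu i| ≤ B → x ∈ Q.supplyDom i →
        Q.cost i (mu i) + Q.marginalCost i (mu i) * (x - mu i) + a * (x - mu i) ^ 2 ≤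
          Q.cost i x)
    {R : ℝ} (hR : 0 < R) (hadm : p.Admissible (Q.scale R))
    (hlamB : ∀ q j, |p.lam q j - R * lam j| ≤ R * B)
    (hmuB : ∀ q i, |p.mu q i - R * mu i| ≤ R * B) (q : State n m) :
    profitRate (Q.scale R) p q ≤ R * Q.fluidObjective lam mu +
      (∑ j, Q.marginalRevenue j (lam j) * (p.lam q j - R * lam j) -
        ∑ i, Q.marginalCost i (mu i) * (p.mu q i - R * mu i)) -
      (∑ j, a * (p.lam q j - R * lam j) ^ 2 / R + ∑ i, a * (p.mu q i - R * mu i) ^ 2 / R) -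
      Q.holdingCost * q.total := by
  have e1 : ∀ j, (Q.scale R).revenue j (p.lam q j) ≤ R * Q.revenue j (lam j) +
      Q.marginalRevenue j (lam j) * (p.lam q j - R * lam j) -
        a * (p.lam q j - R * lam j) ^ 2 / R := by
    intro j
    rw [Q.revenue_scale hR]
    have hx : p.lam q j / R - lam j = (p.lam q j - R * lam j) / R := by field_simp
    have h := hr j (p.lam q j / R) (by
      rw [hx, abs_div, abs_of_pos hR, div_le_iff₀ hR, mul_comm B]
      exact hlamB q j) ((hadm q).1 j)
    rw [hx] at h
    refine (mul_le_mul_of_nonneg_left h hR.le).trans_eq ?_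
    field_simp
  have e2 : ∀ i, R * Q.cost i (mu i) + Q.marginalCost i (mu i) * (p.mu q i - R * mu i) +
      a * (p.mu q i - R * mu i) ^ 2 / R ≤ (Q.scale R).cost i (p.mu q i) := by
    intro i
    rw [Q.cost_scale hR]
    have hx : p.mu q i / R - mu i = (p.mu q i - R * mu i) / R := by field_simp
    have h := hc i (p.mu q i / R) (by
      rw [hx, abs_div, abs_of_pos hR, div_le_iff₀ hR, mul_comm B]
      exact hmuB q i) ((hadm q).2 i)
    rw [hx] at h
    refine le_trans (Eq.le ?_) (mul_le_mul_of_nonneg_left h hR.le)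
    field_simp
  have e3 := Finset.sum_le_sum fun j (_ : j ∈ Finset.univ) => e1 j
  have e4 := Finset.sum_le_sum fun i (_ : i ∈ Finset.univ) => e2 i
  rw [Finset.sum_sub_distrib, Finset.sum_add_distrib, ← Finset.mul_sum] at e3
  rw [Finset.sum_add_distrib, Finset.sum_add_distrib, ← Finset.mul_sum] at e4
  have e5 : profitRate (Q.scale R) p q = ∑ j, (Q.scale R).revenue j (p.lam q j) -
      ∑ i, (Q.scale R).cost i (p.mu q i) - Q.holdingCost * q.total := rfl
  rw [e5, TwoSidedQueue.fluidObjective, mul_sub]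
  linarith

/-- Boundedly deviating rates earn a bounded profit before holding costs. -/
theorem exists_profitRate_le {lam : Fin m → ℝ} {mu : Fin n → ℝ} {a B : ℝ} (ha : 0 ≤ a)
    (hr : ∀ j x, |x - lam j| ≤ B → x ∈ Q.demandDom j → Q.revenue j x ≤
        Q.revenue j (lam j) + Q.marginalRevenue j (lam j) * (x - lam j) - a * (x - lam j) ^ 2)
    (hc : ∀ i x, |x - mu i| ≤ B → x ∈ Q.supplyDom i →
        Q.cost i (mu i) + Q.marginalCost i (mu i) * (x - mu i) + a * (x - mu i) ^ 2 ≤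
          Q.cost i x)
    {R : ℝ} (hR : 0 < R) (hadm : p.Admissible (Q.scale R))
    (hlamB : ∀ q j, |p.lam q j - R * lam j| ≤ R * B)
    (hmuB : ∀ q i, |p.mu q i - R * mu i| ≤ R * B) :
    ∃ C, ∀ q, profitRate (Q.scale R) p q ≤ C - Q.holdingCost * q.total := by
  refine ⟨R * Q.fluidObjective lam mu + (∑ j, |Q.marginalRevenue j (lam j)| * (R * B) +
    ∑ i, |Q.marginalCost i (mu i)| * (R * B)), fun q => ?_⟩
  have h1 : ∑ j, Q.marginalRevenue j (lam j) * (p.lam q j - R * lam j) ≤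
      ∑ j, |Q.marginalRevenue j (lam j)| * (R * B) := by
    refine Finset.sum_le_sum fun j _ => (le_abs_self _).trans ?_
    rw [abs_mul]
    exact mul_le_mul_of_nonneg_left (hlamB q j) (abs_nonneg _)
  have h2 : ∑ i, -(Q.marginalCost i (mu i) * (p.mu q i - R * mu i)) ≤
      ∑ i, |Q.marginalCost i (mu i)| * (R * B) := by
    refine Finset.sum_le_sum fun i _ => (neg_le_abs _).trans ?_
    rw [abs_mul]
    exact mul_le_mul_of_nonneg_left (hmuB q i) (abs_nonneg _)
  have h3 : 0 ≤ ∑ j, a * (p.lam q j - R * lam j) ^ 2 / R := by positivity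
  have h4 : 0 ≤ ∑ i, a * (p.mu q i - R * mu i) ^ 2 / R := by positivity
  have h5 := profitRate_le_quadratic hr hc hR hadm hlamB hmuB q
  rw [Finset.sum_neg_distrib] at h2
  linarith

/-- The profit rate in the system of scale `R = θ⁻³` is at most the fluid value, up to a linear
term and a generator term, minus a multiple of `R θ² = R ^ (1 / 3)`. -/
theorem profitRate_le {lam : Fin m → ℝ} {mu : Fin n → ℝ} {a B : ℝ} (ha : 0 < a)
    (hr : ∀ j x, |x - lam j| ≤ B → x ∈ Q.demandDom j → Q.revenue j x ≤
        Q.revenue j (lam j) + Q.marginalRevenue j (lam j) * (x - lam j) - a * (x - lam j) ^ 2)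
    (hc : ∀ i x, |x - mu i| ≤ B → x ∈ Q.supplyDom i →
        Q.cost i (mu i) + Q.marginalCost i (mu i) * (x - mu i) + a * (x - mu i) ^ 2 ≤
          Q.cost i x)
    {R θ : ℝ} (hR : 0 < R) (h0 : 0 ≤ θ) (h1 : θ ≤ 1) (hRθ : R * θ ^ 3 = 1)
    (hadm : p.Admissible (Q.scale R))
    (hlamB : ∀ q j, |p.lam q j - R * lam j| ≤ R * B)
    (hmuB : ∀ q i, |p.mu q i - R * mu i| ≤ R * B)
    (hpos : 0 < ∑ j, lam j) (hbal : ∑ i, mu i = ∑ j, lam j) {A : ℝ} (hA : 0 ≤ A)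
    (hAs : A * ∑ j, lam j ≤ Q.holdingCost) (hAa : (n + m) * A ≤ a * (∑ j, lam j) / 8)
    (σ : MatchingPolicy (Q.scale R)) (q : State n m) :
    profitRate (Q.scale R) p q ≤ R * Q.fluidObjective lam mu +
      (∑ j, Q.marginalRevenue j (lam j) * (p.lam q j - R * lam j) -
        ∑ i, Q.marginalCost i (mu i) * (p.mu q i - R * mu i)) -
      A * (∑ j, lam j) / 8 * (R * θ ^ 2) +
      A * generator p σ (fun q => -Real.cos (θ * imbalance q)) q := by
  set L := ∑ j, lam j with hL
  set F : Fin m → ℝ := fun j => p.lam q j - R * lam j with hF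
  set G : Fin n → ℝ := fun i => p.mu q i - R * mu i with hG
  have e3 := profitRate_le_quadratic hr hc hR hadm hlamB hmuB q
  have e5 := Finset.sum_le_sum fun j (_ : j ∈ Finset.univ) =>
    neg_sq_le_sub_abs (A := A) (θ := θ) ha hR (F j)
  have e6 := Finset.sum_le_sum fun i (_ : i ∈ Finset.univ) =>
    neg_sq_le_sub_abs (A := A) (θ := θ) ha hR (G i)
  simp only [Finset.sum_sub_distrib, ← Finset.mul_sum, Finset.sum_const,
    Finset.card_univ, Fintype.card_fin, nsmul_eq_mul] at e5 e6
  have hgen := generator_cos_ge (p := p) σ (L := R * L) (u := ∑ j, F j) (v := ∑ i, G i)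
    (by positivity) h0 h1 q
    (by simp [hF, Finset.sum_sub_distrib, ← Finset.mul_sum, hL])
    (by simp [hG, Finset.sum_sub_distrib, ← Finset.mul_sum, hL, hbal])
  have hgenA := mul_le_mul_of_nonneg_left hgen hA
  have hFabs : |∑ j, F j| ≤ ∑ j, |F j| := Finset.abs_sum_le_sum_abs _ _
  have hGabs : |∑ i, G i| ≤ ∑ i, |G i| := Finset.abs_sum_le_sum_abs _ _
  have e7 := mul_le_mul_of_nonneg_left hFabs (show 0 ≤ 2 * A * θ by positivity)
  have e8 := mul_le_mul_of_nonneg_left hGabs (show 0 ≤ 2 * A * θ by positivity)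
  -- The generator contributes `2 * (A * L / 8 * (R * θ ^ 2))`. Completing the squares for all types
  -- uses up at most half of it; the other half is the gain.
  have e9 : (n + m) * (A ^ 2 * θ ^ 2 * R / a) ≤ A * L / 8 * (R * θ ^ 2) := by
    have := mul_le_mul_of_nonneg_right hAa (show 0 ≤ A * θ ^ 2 * R / a by positivity)
    calc (n + m) * (A ^ 2 * θ ^ 2 * R / a) = (n + m) * A * (A * θ ^ 2 * R / a) := by ring
      _ ≤ a * L / 8 * (A * θ ^ 2 * R / a) := this
      _ = A * L / 8 * (R * θ ^ 2) := by field_simp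
  have e10 : A * L * |imbalance q| ≤ Q.holdingCost * q.total := by
    refine mul_le_mul hAs (abs_imbalance_le q) (abs_nonneg _) ?_
    exact le_trans (by positivity) hAs
  -- With `R * θ ^ 3 = 1` the coefficient of `|imbalance q|` no longer depends on the scale, so a
  -- fixed multiple of the holding cost pays for it.
  have e11 : A * (R * L * θ ^ 2 / 4 - R * L * θ ^ 3 * |imbalance q| -
      2 * θ * (|∑ j, F j| + |∑ i, G i|)) = 2 * (A * L / 8 * (R * θ ^ 2)) -
        A * L * |imbalance q| - 2 * A * θ * |∑ j, F j| - 2 * A * θ * |∑ i, G i| := by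
    have : R * L * θ ^ 3 = L := by
      calc R * L * θ ^ 3 = L * (R * θ ^ 3) := by ring
        _ = L := by rw [hRθ, mul_one]
    rw [this]
    ring
  rw [e11] at hgenA
  linarith

end Tradeoff

/-! ### From the pointwise bound to the long-run profit -/

section LongRun

variable {n m : ℕ} {Q : TwoSidedQueue n m} {p : PricingPolicy n m} {c : ℝ}

/-- A pointwise bound on the profit rate by the fluid value minus `ε`, up to marginal profits of
the deviations and the generator of a bounded function, bounds the long-run profit. -/
theorem longRunProfit_le (hQ : Q.Regular) {lam : Fin m → ℝ} {mu : Fin n → ℝ}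
    (hopt : Q.FluidOptimal lam mu) {R : ℝ} (hR : 0 < R) (hp : Uniformizable p c)
    (hadm : p.Admissible (Q.scale R)) (σ : MatchingPolicy (Q.scale R)) {C ε A : ℝ}
    {h : State n m → ℝ} (hh : ∀ q, |h q| ≤ 1) (hA : 0 ≤ A)
    (hC : ∀ q, profitRate (Q.scale R) p q ≤ C - Q.holdingCost * q.total)
    (hbound : ∀ q, profitRate (Q.scale R) p q ≤ R * Q.fluidObjective lam mu +
      (∑ j, Q.marginalRevenue j (lam j) * (p.lam q j - R * lam j) -
        ∑ i, Q.marginalCost i (mu i) * (p.mu q i - R * mu i)) - ε + A * generator p σ h q) :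
    longRunProfit p σ c ≤ ((R * Q.fluidObjective lam mu - ε : ℝ) : EReal) := by
  by_contra hlt
  push Not at hlt
  -- A level `w` strictly between the bound and the long-run profit is exceeded by the average
  -- profit at infinitely many horizons.
  obtain ⟨w, hw1, hw2⟩ := EReal.lt_iff_exists_real_btwn.1 hlt
  have hw1' : R * Q.fluidObjective lam mu - ε < w := by exact_mod_cast hw1
  have hs := hQ.holdingCost_pos
  have hfreq := (frequently_lt_of_lt_limsup (by isBoundedDefault) hw2).and_eventually
    (eventually_gt_atTop 0)
  obtain ⟨ν, hν, hνw⟩ := extraction_of_frequently_atTop hfreq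
  have hprofit : ∀ k, w < average hp σ (ν k) (profitRate (Q.scale R) p) := by
    intro k
    have := (hνw k).1
    rw [averageProfit_eq hp] at this
    exact_mod_cast this
  -- Profit before holding costs is at most `C`, so profit above `w` leaves at most `C - w` for
  -- holding.
  have hqueue : ∀ k, average hp σ (ν k) (fun q => (q.total : ℝ)) ≤ (C - w) / Q.holdingCost := by
    intro k
    have h1 := (hprofit k).trans_le (average_mono hp σ (ν k) hC)
    rw [average_sub, average_mul_left, average_const hp σ (hνw k).2] at h1
    rw [le_div_iff₀ hs]
    linarith
  obtain ⟨φ, χ, hφ, hχ0, hχz, hlamlim, hmulim⟩ := exists_limit_flow hp σ hν hqueue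
  have hνφ : Tendsto (fun k => ν (φ k)) atTop atTop := (hν.comp hφ).tendsto_atTop
  have havg : ∀ k, w ≤ R * Q.fluidObjective lam mu +
      (∑ j, Q.marginalRevenue j (lam j) *
          (average hp σ (ν (φ k)) (fun q => p.lam q j) - R * lam j) -
        ∑ i, Q.marginalCost i (mu i) *
          (average hp σ (ν (φ k)) (fun q => p.mu q i) - R * mu i)) - ε +
      A * (2 * c) / ν (φ k) := by
    intro k
    have hk := (hνw (φ k)).2
    have hcst := average_const hp σ hk
    refine ((hprofit (φ k)).trans_le (average_mono hp σ _ hbound)).le.trans ?_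
    rw [average_add, average_sub, average_add, average_sub, average_sum, average_sum, hcst, hcst,
      average_mul_left]
    simp only [average_mul_left, average_sub, hcst]
    gcongr
    change A * average hp σ (ν (φ k)) (generator p σ h) ≤ _
    rw [average_generator, ← mul_div_assoc]
    gcongr A * ?_ / _
    -- Since `|h| ≤ 1`, Dynkin's formula leaves at most `2 * c` over the horizon.
    have h1 : expect (chainLaw hp σ (ν (φ k))) h ≤ 1 :=
      (expect_mono (chainLaw_support_finite hp σ _) fun q _ => (abs_le.1 (hh q)).2).trans_eq
        (expect_const (chainLaw_support_finite hp σ _) 1)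
    have h2 := (abs_le.1 (hh 0)).1
    nlinarith [hp.pos]
  have hlim := ((tendsto_const_nhds (x := R * Q.fluidObjective lam mu)).add
    ((tendsto_finsetSum Finset.univ fun j _ =>
      ((hlamlim j).sub_const (R * lam j)).const_mul (Q.marginalRevenue j (lam j))).sub
    (tendsto_finsetSum Finset.univ fun i _ =>
      ((hmulim i).sub_const (R * mu i)).const_mul (Q.marginalCost i (mu i))))).sub_const ε
  have hlim' := hlim.add ((tendsto_const_div_atTop_nhds_zero_nat (A * (2 * c))).comp hνφ)
  have hle := ge_of_tendsto' hlim' havg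
  -- Average rates stay in the convex domains, but these need not be closed, so the limits are only
  -- known to lie in the closures.
  have hscale : ∀ {D : Set ℝ} {u : ℕ → ℝ} {x : ℝ}, Tendsto u atTop (𝓝 x) →
      (∀ k, u k / R ∈ D) → x / R ∈ closure D := fun hu hm =>
    mem_closure_of_tendsto (hu.div_const R) (Eventually.of_forall hm)
  have hmean : ∀ {D : Set ℝ} {ψ : State n m → ℝ}, Convex ℝ D → (∀ q, ψ q / R ∈ D) →
      ∀ k, average hp σ (ν (φ k)) ψ / R ∈ D := by
    intro D ψ hD hψ k
    have := sum_expect_mem_convex (chainLaw_support_finite hp σ) hD hψ (hνw (φ k)).2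
    simp only [div_eq_inv_mul _ R, expect_mul_left, ← Finset.mul_sum] at this ⊢
    rwa [mul_div_assoc] at this
  have hfoc := hopt.first_order hQ (χ' := fun i j => χ i j / R)
    (fun i j => div_nonneg (hχ0 i j) hR.le) (fun i j hij => by rw [hχz i j hij, zero_div])
    (fun j => by
      rw [← Finset.sum_div]
      exact hscale (hlamlim j) (hmean (hQ.demandDom j).convex fun q => (hadm q).1 j))
    (fun i => by
      rw [← Finset.sum_div]
      exact hscale (hmulim i) (hmean (hQ.supplyDom i).convex fun q => (hadm q).2 i))
  have hfocR := mul_nonpos_of_nonneg_of_nonpos hR.le hfoc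
  rw [mul_sub, Finset.mul_sum, Finset.mul_sum] at hfocR
  have e1 : ∀ d x y : ℝ, R * (d * (x / R - y)) = d * (x - R * y) := by
    intro d x y
    field_simp
  simp only [← Finset.sum_div, e1] at hfocR
  linarith

end LongRun

/-! ### Consequences of admissibility and of the size of the adjustments -/

section Admissible

variable {n m : ℕ} {Q : TwoSidedQueue n m}

theorem TwoSidedQueue.FluidOptimal.sum_eq {lam : Fin m → ℝ} {mu : Fin n → ℝ}
    (h : Q.FluidOptimal lam mu) : ∑ i, mu i = ∑ j, lam j := by
  obtain ⟨χ, hf⟩ := h.1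
  simp only [hf.lam_eq, hf.mu_eq]
  exact Finset.sum_comm

theorem uniformizable_of_admissible (hQ : Q.Regular) {R : ℝ} (hR : 0 < R) {p : PricingPolicy n m}
    (hadm : p.Admissible (Q.scale R)) {c : ℝ} (hc : 0 < c) (htot : ∀ q, p.totalRate q ≤ c) :
    Uniformizable p c where
  pos := hc
  rate_nonneg q a := by
    have : ∀ x : ℝ, 0 ≤ x / R → 0 ≤ x := fun x hx => by
      simpa [div_mul_cancel₀ _ hR.ne'] using mul_nonneg hx hR.le
    cases a with
    | inl i => exact this _ ((hQ.supplyDom i).nonneg _ ((hadm q).2 i))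
    | inr j => exact this _ ((hQ.demandDom j).nonneg _ ((hadm q).1 j))
  totalRate_le := htot

/-- As `β ≤ 1`, the rates divided by `R` stay within `B` of the fluid optimum, the range where one
curvature constant works for all scales. -/
theorem abs_mul_rpow_le {x b B R β : ℝ} (hx : |x| ≤ b) (hb : b ≤ B) (hR : 1 ≤ R) (hβ : β ≤ 1) :
    |x * R ^ β| ≤ R * B := by
  have h1 : R ^ β ≤ R := by simpa using Real.rpow_le_rpow_of_exponent_le hR hβ
  have h0 : 0 ≤ R ^ β := Real.rpow_nonneg (by linarith) β
  rw [abs_mul, abs_of_nonneg h0, mul_comm]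
  exact mul_le_mul h1 (hx.trans hb) (abs_nonneg x) (by linarith)

end Admissible

end TwoSided

end

/-! ### The lower bound on the profit loss -/

theorem mainTheorem3 {n m : ℕ} (Q : TwoSided.TwoSidedQueue n m) (hQ : Q.Regular)
    (lam : Fin m → ℝ) (mu : Fin n → ℝ) (hopt : Q.FluidOptimal lam mu)
    (hpos : 0 < ∑ j, lam j)
    (hrevenue : ∀ j, iteratedDerivWithin 2 (Q.revenue j) (Q.demandDom j) (lam j) < 0)
    (hcost : ∀ i, 0 < iteratedDerivWithin 2 (Q.cost i) (Q.supplyDom i) (mu i))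
    (f : Fin m → (Fin n → ℝ) × (Fin m → ℝ) → ℝ) (g : Fin n → (Fin n → ℝ) × (Fin m → ℝ) → ℝ)
    (M : Fin m → ℝ) (N : Fin n → ℝ) (κ δ : ℝ) (hκ : 0 < κ) (hδ : 0 < δ) :
    ∃ K : ℝ, 0 < K ∧ ∀ α β : ℝ, TwoSided.PricingCondition Q f g M N κ δ α β →
      ∀ η : ℕ, 1 ≤ η →
        (TwoSided.generalPolicy lam mu f g α β η).Admissible (Q.scale η) →
        ∀ c : ℝ, 0 < c →
          (∀ q, (TwoSided.generalPolicy lam mu f g α β η).totalRate q ≤ c) →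
          ∀ σ : TwoSided.MatchingPolicy (Q.scale η),
            TwoSided.Stable (TwoSided.generalPolicy lam mu f g α β η) σ c →
            ((K * (η : ℝ) ^ ((1 : ℝ) / 3) : ℝ) : EReal) ≤
              TwoSided.profitLoss (TwoSided.generalPolicy lam mu f g α β η) σ c := by
  obtain ⟨χ, hf⟩ := hopt.1
  set B : ℝ := 1 + ∑ j, |M j| + ∑ i, |N i| with hB
  have hM0 : 0 ≤ ∑ j, |M j| := Finset.sum_nonneg fun _ _ => abs_nonneg _
  have hN0 : 0 ≤ ∑ i, |N i| := Finset.sum_nonneg fun _ _ => abs_nonneg _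
  have hMB : ∀ j, M j ≤ B := fun j => by
    have := Finset.single_le_sum (f := fun j => |M j|) (fun _ _ => abs_nonneg _)
      (Finset.mem_univ j)
    linarith [le_abs_self (M j)]
  have hNB : ∀ i, N i ≤ B := fun i => by
    have := Finset.single_le_sum (f := fun i => |N i|) (fun _ _ => abs_nonneg _)
      (Finset.mem_univ i)
    linarith [le_abs_self (N i)]
  obtain ⟨a, ha, har, hac⟩ := hQ.exists_quadratic_loss hf.lam_mem hf.mu_mem hrevenue hcost
    (B := B) (by linarith)
  set L := ∑ j, lam j
  have hs := hQ.holdingCost_pos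
  -- The weight of the test function: the first entry keeps the imbalance error below the holding
  -- cost, the second keeps the completed squares below half of the gain. The summand `1` only makes
  -- the denominator positive.
  set A : ℝ := min (Q.holdingCost / L) (a * L / (8 * (n + m + 1)))
  have hA : 0 < A := lt_min (by positivity) (by positivity)
  have hAs : A * L ≤ Q.holdingCost := by
    rw [← le_div_iff₀ hpos]
    exact min_le_left _ _
  have hAa : (n + m) * A ≤ a * L / 8 := by
    have h1 : A * (8 * (n + m + 1)) ≤ a * L := by
      rw [← le_div_iff₀ (by positivity)]
      exact min_le_right _ _
    linarith
  refine ⟨A * L / 8, by positivity, fun α β hcond η hη => ?_⟩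
  have hR1 : (1 : ℝ) ≤ η := by exact_mod_cast hη
  set R : ℝ := (η : ℝ) with hRdef
  intro hadm c hc htot σ _
  set p := TwoSided.generalPolicy lam mu f g α β η with hp
  have hR : 0 < R := by linarith
  -- The frequency at which price variability and holding cost balance; the gain `R * θ ^ 2` is then
  -- `R ^ (1/3)`.
  set θ : ℝ := R ^ (-(1 : ℝ) / 3) with hθ
  have hθ0 : 0 < θ := Real.rpow_pos_of_pos hR _
  have hθ1 : θ ≤ 1 := Real.rpow_le_one_of_one_le_of_nonpos hR1 (by norm_num)
  have hRθ : R * θ ^ 3 = 1 := by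
    rw [hθ, ← Real.rpow_natCast, ← Real.rpow_mul hR.le]
    norm_num
    rw [Real.rpow_neg_one, mul_inv_cancel₀ hR.ne']
  have hRθ2 : R * θ ^ 2 = R ^ ((1 : ℝ) / 3) := by
    rw [hθ, ← Real.rpow_natCast, ← Real.rpow_mul hR.le]
    nth_rewrite 1 [← Real.rpow_one R]
    rw [← Real.rpow_add hR]
    norm_num
  have hlamB : ∀ q j, |p.lam q j - R * lam j| ≤ R * B := fun q j => by
    simp only [hp, TwoSided.generalPolicy, ← hRdef, add_sub_cancel_left]
    exact TwoSided.abs_mul_rpow_le (hcond.f_bounded η hη q j) (hMB j) hR1 hcond.beta_mem.2.le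
  have hmuB : ∀ q i, |p.mu q i - R * mu i| ≤ R * B := fun q i => by
    simp only [hp, TwoSided.generalPolicy, ← hRdef, add_sub_cancel_left]
    exact TwoSided.abs_mul_rpow_le (hcond.g_bounded η hη q i) (hNB i) hR1 hcond.beta_mem.2.le
  have hunif := TwoSided.uniformizable_of_admissible hQ hR hadm hc htot
  obtain ⟨C, hC⟩ := TwoSided.exists_profitRate_le ha.le har hac hR hadm hlamB hmuB
  have hlong := TwoSided.longRunProfit_le hQ hopt hR hunif hadm σ
    (h := fun q => -Real.cos (θ * TwoSided.imbalance q)) (A := A)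
    (ε := A * L / 8 * (R * θ ^ 2))
    (fun q => by rw [abs_neg]; exact Real.abs_cos_le_one _) hA.le
    hC
    (TwoSided.profitRate_le ha har hac hR hθ0.le hθ1 hRθ hadm hlamB hmuB hpos hopt.sum_eq hA.le
      hAs hAa σ)
  rw [hRθ2] at hlong
  have hval : ((R * Q.fluidObjective lam mu : ℝ) : EReal) ≤ (Q.scale R).fluidValue := by
    exact_mod_cast hopt.le_fluidValue_scale hR
  refine le_trans (Eq.le ?_) (EReal.sub_le_sub hval hlong)
  rw [← EReal.coe_sub]
  congr 1
  ring
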